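/- Let $\Omega\subset\mathbb R^2$ be a bounded domain with $C^2$ boundary, and let $D\subset\mathbb R^2$ be a convex polygon (the nonempty interior of the convex hull of finitely many points) with $\overline D\subset\Omega$ and $\Omega\setminus\overline D$ connected. Let $f\in H^{1/2}(\partial\Omega)$ be not identically zero, and let $u\in H^1(\Omega\setminus\overline D)$ be the solution of $$\Delta u=0\ \text{ in }\Omega\setminus\overline D,\qquad u=0\ \text{ on }\partial D,\qquad u=f\ \text{ on }\partial\Omega,$$ where the boundary values are understood in the sense of traces and $u$ denotes the smooth (harmonic) representative. Assume that one of the following holds: (i) all corners of $D$ have irrational angles, i.e. every interior angle $\theta$ of $D$ has the form $\theta=2\pi\alpha$ with $\alpha\notin\mathbb Q$; (ii) $\operatorname{diam} D<\operatorname{dist}(D,\partial\Omega)$. Then $u$ cannot be analytically continued across any corner of $D$: for every corner $a$ of $D$ there do not exist an open neighbourhood $V$ of $a$ and a real-analytic function $v:V\to\mathbb R$ with $v=u$ on $V\cap(\Omega\setminus\overline D)$. -/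

import Mathlib

open MeasureTheory Filter Topology Set
open scoped ContDiff

noncomputable section

/-- The Euclidean plane `ℝ²`. -/
abbrev Plane : Type := EuclideanSpace ℝ (Fin 2)

/-! ### Sobolev spaces and traces -/

/-- `g` is the weak (distributional) gradient of `u` on `U`. -/
structure IsWeakGradient (U : Set Plane) (u : Plane → ℝ) (g : Plane → Plane) : Prop where
  locallyIntegrable_fun : LocallyIntegrableOn u U
  locallyIntegrable_grad : LocallyIntegrableOn g U
  integral_eq : ∀ ψ : Plane → ℝ, ContDiff ℝ ∞ ψ → HasCompactSupport ψ → tsupport ψ ⊆ U →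
    ∫ x in U, u x • gradient ψ x = - ∫ x in U, ψ x • g x

/-- `u ∈ H¹(U)`: `u` is square integrable on `U` and so is its weak gradient. -/
def MemH1 (U : Set Plane) (u : Plane → ℝ) : Prop :=
  MemLp u 2 (volume.restrict U) ∧
    ∃ g : Plane → Plane, MemLp g 2 (volume.restrict U) ∧ IsWeakGradient U u g

/-- The sequence `φ` of smooth functions on the plane converges to `u` in `H¹(U)`. -/
def TendstoH1 (U : Set Plane) (φ : ℕ → Plane → ℝ) (u : Plane → ℝ) : Prop :=
  ∃ g : Plane → Plane, MemLp g 2 (volume.restrict U) ∧ IsWeakGradient U u g ∧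
    Tendsto (fun k => eLpNorm (fun x => φ k x - u x) 2 (volume.restrict U)) atTop (𝓝 0) ∧
    Tendsto (fun k => eLpNorm (fun x => gradient (φ k) x - g x) 2 (volume.restrict U))
      atTop (𝓝 0)

/-- Arc length measure on the curve `Γ`. -/
def arcLength (Γ : Set Plane) : Measure Plane := (Measure.hausdorffMeasure 1).restrict Γ

/-- `u ∈ H¹(U)` has trace `h` on the part `Γ` of the boundary of the (Lipschitz) set `U`:
the trace operator is the extension by continuity, from `H¹(U)` to `L²(Γ)`, of the restriction
map `φ ↦ φ|_Γ` defined on functions that are smooth up to the boundary. -/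
def HasTrace (U Γ : Set Plane) (u h : Plane → ℝ) : Prop :=
  MemH1 U u ∧ MemLp h 2 (arcLength Γ) ∧
    ∃ φ : ℕ → Plane → ℝ, (∀ k, ContDiff ℝ ∞ (φ k)) ∧ TendstoH1 U φ u ∧
      Tendsto (fun k => eLpNorm (fun x => φ k x - h x) 2 (arcLength Γ)) atTop (𝓝 0)

/-- `f ∈ H^{1/2}(Γ)` for a curve `Γ` in the plane (Sobolev–Slobodeckij norm). -/
def MemHHalf (Γ : Set Plane) (f : Plane → ℝ) : Prop :=
  MemLp f 2 (arcLength Γ) ∧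
    ∫⁻ x, ∫⁻ y, ‖f x - f y‖ₑ ^ 2 / edist x y ^ 2 ∂(arcLength Γ) ∂(arcLength Γ) < ⊤

/-! ### Domains -/

/-- `Ω` is a bounded domain with `C²` boundary: it is open, connected, nonempty, bounded, and near
every boundary point it is, in suitable Cartesian coordinates, the region above the graph of a
`C²` function. -/
structure IsBoundedC2Domain (Ω : Set Plane) : Prop where
  isOpen : IsOpen Ω
  isConnected : IsConnected Ω
  isBounded : Bornology.IsBounded Ω
  locally_graph : ∀ x ∈ frontier Ω, ∃ (V : Set Plane) (e : Plane ≃ᵃⁱ[ℝ] Plane) (γ : ℝ → ℝ),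
    IsOpen V ∧ x ∈ V ∧ ContDiff ℝ 2 γ ∧ ∀ y ∈ V, (y ∈ Ω ↔ γ (e y 0) < e y 1)

/-- The cross product `v₀ w₁ - v₁ w₀`, positive iff `w` points to the left of `v`. -/
def cross (v w : Plane) : ℝ := v 0 * w 1 - v 1 * w 0

/-- The vertices `P 0, …, P (n - 1)` are the corners of a convex polygon, listed counterclockwise:
for every edge from `P i` to `P (i + 1)` (indices mod `n`), all the other vertices lie strictly
to the left of it. -/
structure IsConvexPolygon {n : ℕ} [NeZero n] (P : Polygon Plane n) : Prop where
  three_le : 3 ≤ n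
  left_of_edge : ∀ i j : Fin n, j ≠ i → j ≠ i + 1 → 0 < cross (P (i + 1) - P i) (P j - P i)

/-- The open region bounded by the convex polygon with vertices `P`. -/
def polygonRegion {n : ℕ} (P : Polygon Plane n) : Set Plane :=
  interior (convexHull ℝ (range P.vertices))

/-- The interior angle of the convex polygon at its corner `P i`. -/
def cornerAngle {n : ℕ} [NeZero n] (P : Polygon Plane n) (i : Fin n) : ℝ :=
  EuclideanGeometry.angle (P (i - 1)) (P i) (P (i + 1))

/-- An angle `θ` is irrational if `θ = 2πα` with `α ∉ ℚ`. -/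
def IsIrrationalAngle (θ : ℝ) : Prop := ∃ α : ℝ, Irrational α ∧ θ = 2 * Real.pi * α

/-- The distance `inf {|x - y| : x ∈ A, y ∈ B}` of two nonempty sets. -/
def setDist (A B : Set Plane) : ℝ := sInf (image2 dist A B)

/-! ### The boundary value problem and analytic continuation -/

/-- `u ∈ H¹(Ω \ D̄)` solves `Δu = 0` in `Ω \ D̄`, `u = 0` on `∂D`, `u = f` on `∂Ω`. Harmonicity is
stated for the (unique) smooth representative `u`, the boundary values are traces. -/
structure IsSolution (Ω D : Set Plane) (f u : Plane → ℝ) : Prop where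
  memH1 : MemH1 (Ω \ closure D) u
  harmonic : InnerProductSpace.HarmonicOnNhd u (Ω \ closure D)
  trace_inner : HasTrace (Ω \ closure D) (frontier D) u (fun _ => 0)
  trace_outer : HasTrace (Ω \ closure D) (frontier Ω) u f

/-- `u`, given in `Ω \ D̄`, can be analytically continued across the boundary point `a` of `D`:
on some open neighbourhood of `a` there is a real analytic function that coincides with `u`
outside `D̄`. (For harmonic `u` the continuation is automatically harmonic near `a`.) -/
def HasAnalyticContinuationAt (Ω D : Set Plane) (u : Plane → ℝ) (a : Plane) : Prop :=
  ∃ (V : Set Plane) (v : Plane → ℝ), IsOpen V ∧ a ∈ V ∧ AnalyticOnNhd ℝ v V ∧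
    ∀ x ∈ V ∩ (Ω \ closure D), v x = u x

end

/-! Suppose `u` continues to an analytic `v` near the corner `a`. It is shown that `u` vanishes
identically; its trace on `∂Ω` is then zero, against the assumption on `f`.

The identity theorem applied to `Δv` makes `v` harmonic in a disc about `a`, so `v = Re F` with `F`
holomorphic. The zero trace on the two edges at `a` forces `v = 0` on them, and Schwarz reflection
(`conj_comp_reflect_eq_neg`) gives `conj (F ∘ R) = -F` for the reflection `R` in either edge line.

Irrational angle: the product of the two reflections is a rotation about `a` by twice the angle. It
has infinite order and leaves `F` invariant, so by comparing leading Taylor coefficients `F` is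
constant near `a` (`eventually_eq_const_of_rotation_invariant`). Oddness at `a` gives `Re F(a) = 0`,
hence `u = 0` near `a` and so everywhere.

Small diameter: some disc about `a` contains `D̄` and lies in `Ω`. The exterior of the corner cone
and its mirror images in both edge lines cover the punctured disc. Since `v` is odd under both
reflections, `u` and its odd reflections glue to a harmonic `w` on the whole disc
(`exists_harmonic_extension`). Unique continuation gives `w = u` outside `D̄`
(`eqOn_ball_diff_convex`), so `w = 0` on `∂D`. The maximum principle gives `w = 0` in `D`, hence `w
= 0` and `u = 0`.

Two facts connect this with Sobolev traces, both proved by one-dimensional estimates along the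
fibres of thin strips of width `δ`. A continuous extension of `u` to an edge with zero trace
vanishes there: if `|u| ≥ c` near the edge, the `L²` mass of a strip has order at least `δ`, while
zero trace bounds it by order `δ²` (`not_bounded_below_of_trace_zero`). Conversely, `u = 0` forces a
zero outer trace, because the `H¹` norm on a strip controls the `L²` norm on its base
(`trace_ae_eq_zero_of_strip`). -/

noncomputable section

open InnerProductSpace Complex

open scoped ComplexConjugate

/-! ### Harmonicity under Euclidean motions. -/

section Laplacian

variable {E E' : Type*} [NormedAddCommGroup E] [InnerProductSpace ℝ E] [FiniteDimensional ℝ E]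
  [NormedAddCommGroup E'] [InnerProductSpace ℝ E'] [FiniteDimensional ℝ E']

/-- The Laplacian is invariant under Euclidean motions. -/
theorem laplacian_comp_isometry (T : E ≃ₗᵢ[ℝ] E') (c : E') (f : E' → ℝ) (x : E) :
    Laplacian.laplacian (fun y => f (T y + c)) x = Laplacian.laplacian f (T x + c) := by
  let b := stdOrthonormalBasis ℝ E
  have h : (fun y => f (T y + c)) = (fun z => f (z + c)) ∘ T.toContinuousLinearEquiv := rfl
  rw [laplacian_eq_iteratedFDeriv_orthonormalBasis _ b,
    laplacian_eq_iteratedFDeriv_orthonormalBasis f (b.map T), h]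
  refine Finset.sum_congr rfl fun i _ => ?_
  have := T.toContinuousLinearEquiv.iteratedFDerivWithin_comp_right (fun z => f (z + c))
    uniqueDiffOn_univ (x := x) (mem_univ _) 2
  simp only [preimage_univ, iteratedFDerivWithin_univ] at this
  rw [this, iteratedFDeriv_comp_add_right]
  simp only [ContinuousMultilinearMap.compContinuousLinearMap_apply]
  congr 1
  ext j
  fin_cases j <;> rfl

theorem HarmonicAt_comp_isometry (T : E ≃ₗᵢ[ℝ] E') (c : E') {f : E' → ℝ} {x : E}
    (h : HarmonicAt f (T x + c)) : HarmonicAt (fun y => f (T y + c)) x := by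
  have hc : ContDiff ℝ 2 (fun y => T y + c) := T.contDiff.add contDiff_const
  refine ⟨h.1.comp x hc.contDiffAt, ?_⟩
  have ht : Tendsto (fun y => T y + c) (𝓝 x) (𝓝 (T x + c)) := hc.continuous.continuousAt
  filter_upwards [ht.eventually h.2] with y hy
  rw [laplacian_comp_isometry, hy]
  rfl

end Laplacian

/-! ### Reflection, rotation invariance, gluing along rays, maximum principle. -/

/-- The reflection `z ↦ a + c conj (z - a)` in the line through `a` with direction `e`, where
`c = e / conj e`. -/
def reflect (a c z : ℂ) : ℂ := a + c * conj (z - a)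

theorem reflect_sub (a c z : ℂ) : reflect a c z - a = c * conj (z - a) := by
  simp [reflect]

theorem norm_reflect_sub {c : ℂ} (hc : ‖c‖ = 1) (a z : ℂ) : ‖reflect a c z - a‖ = ‖z - a‖ := by
  rw [reflect_sub, norm_mul, hc, one_mul, RCLike.norm_conj]

theorem reflect_mem_ball {c : ℂ} (hc : ‖c‖ = 1) {a z : ℂ} {r : ℝ} (hz : z ∈ Metric.ball a r) :
    reflect a c z ∈ Metric.ball a r := by
  rw [mem_ball_iff_norm] at *
  rwa [norm_reflect_sub hc]

theorem reflect_ray (a c z : ℂ) (t : ℝ) :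
    reflect a c (a + t * (z - a)) = a + t * (reflect a c z - a) := by
  simp [reflect]; ring

theorem harmonicAt_comp_reflect {a c z : ℂ} (hc : ‖c‖ = 1) {u : ℂ → ℝ}
    (h : HarmonicAt u (reflect a c z)) : HarmonicAt (fun y => u (reflect a c y)) z := by
  let k : Circle := ⟨c, by simpa [Submonoid.unitSphere] using hc⟩
  let T : ℂ ≃ₗᵢ[ℝ] ℂ := conjLIE.trans (rotation k)
  have hT : ∀ y, reflect a c y = T y + (a - c * conj a) := by
    intro y
    have : T y = c * conj y := rfl
    rw [this]
    simp [reflect]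
    ring
  simp only [hT] at h ⊢
  exact HarmonicAt_comp_isometry T _ h

theorem continuous_reflect (a c : ℂ) : Continuous (reflect a c) := by
  unfold reflect
  fun_prop

/-- Schwarz reflection: a holomorphic function whose real part vanishes on a segment emanating
from the centre of the ball is odd with respect to the reflection in that segment. -/
theorem conj_comp_reflect_eq_neg {a e c : ℂ} {r ε : ℝ} (hε : 0 < ε) (he : e ≠ 0)
    (hce : c * conj e = e) (hc : ‖c‖ = 1) {F : ℂ → ℂ} (hr : 0 < r)
    (hF : AnalyticOnNhd ℂ F (Metric.ball a r))
    (h0 : ∀ t : ℝ, 0 < t → t < ε → (F (a + t * e)).re = 0) {z : ℂ} (hz : z ∈ Metric.ball a r) :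
    conj (F (reflect a c z)) = - F z := by
  have hA : AnalyticOnNhd ℂ (fun z => F z + conj (F (reflect a c z))) (Metric.ball a r) := by
    refine DifferentiableOn.analyticOnNhd (fun z hz => ?_) Metric.isOpen_ball
    -- Both the reflection and the outer conjugation are antiholomorphic. Factoring through `conj ∘
    -- F ∘ conj` and a complex affine map shows that the composite is holomorphic.
    have h1 : DifferentiableAt ℂ (conj ∘ F ∘ conj) (conj (reflect a c z)) :=
      (hF _ (reflect_mem_ball hc hz)).differentiableAt.conj_conj
    have h2 : (fun z => conj (F (reflect a c z))) =
        (conj ∘ F ∘ conj) ∘ fun z => conj a + conj c * (z - a) := by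
      ext z
      simp [reflect]
    have h3 : conj (reflect a c z) = conj a + conj c * (z - a) := by simp [reflect]
    rw [h3] at h1
    have h4 : DifferentiableAt ℂ (fun z => conj (F (reflect a c z))) z := by
      rw [h2]
      exact h1.comp z (by fun_prop)
    exact ((hF z hz).differentiableAt.add h4).differentiableWithinAt
  -- Points of the segment are fixed by the reflection, so there the sum is `2 Re F = 0`; they
  -- accumulate at `a`.
  have hfreq : ∃ᶠ z in 𝓝[≠] a, F z + conj (F (reflect a c z)) = 0 := by
    have ht : Tendsto (fun t : ℝ => a + t * e) (𝓝[>] 0) (𝓝[≠] a) := by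
      refine tendsto_nhdsWithin_iff.2 ⟨?_, ?_⟩
      · have : Continuous fun t : ℝ => a + t * e := by fun_prop
        simpa using (this.tendsto 0).mono_left nhdsWithin_le_nhds
      · filter_upwards [self_mem_nhdsWithin] with t ht
        simpa [he] using (ne_of_gt ht)
    refine ht.frequently (Eventually.frequently ?_)
    filter_upwards [Ioo_mem_nhdsGT hε] with t ht
    have : reflect a c (a + t * e) = a + t * e := by
      simp only [reflect, add_sub_cancel_left, map_mul, conj_ofReal]
      linear_combination (t : ℂ) * hce
    rw [this, add_conj, h0 t ht.1 ht.2]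
    simp
  have := hA.eqOn_zero_of_preconnected_of_frequently_eq_zero
    (convex_ball a r).isPreconnected (Metric.mem_ball_self hr) hfreq hz
  simp only [Pi.zero_apply] at this
  linear_combination this

/-- A holomorphic function that is invariant under a rotation of infinite order about `a` is
constant near `a`. -/
theorem eventually_eq_const_of_rotation_invariant {F : ℂ → ℂ} {a ρ : ℂ} (hF : AnalyticAt ℂ F a)
    (hρ : ∀ n : ℕ, 0 < n → ρ ^ n ≠ 1)
    (h : ∀ᶠ z in 𝓝 a, F (a + ρ * (z - a)) = F z) : ∀ᶠ z in 𝓝 a, F z = F a := by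
  have hH : AnalyticAt ℂ (fun z => F z - F a) a := hF.sub analyticAt_const
  by_contra hne
  obtain ⟨n, g, hg, hga, hev⟩ := hH.exists_eventuallyEq_pow_smul_nonzero_iff.2
    (fun h' => hne (h'.mono fun z hz => sub_eq_zero.1 hz))
  have hn : 0 < n := by
    rcases Nat.eq_zero_or_pos n with rfl | hn
    · exfalso
      have := hev.self_of_nhds
      simp at this
      exact hga this.symm
    · exact hn
  have hrc : Continuous fun z => a + ρ * (z - a) := by fun_prop
  have hr : Tendsto (fun z => a + ρ * (z - a)) (𝓝 a) (𝓝 a) := by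
    simpa using hrc.tendsto a
  -- With `F - F a = (z - a) ^ n g` and `g a ≠ 0`, invariance lets the factor `(z - a) ^ n` cancel.
  -- Letting `z → a` then gives `ρ ^ n = 1`.
  have hkey : ∀ᶠ z in 𝓝[≠] a, ρ ^ n * g (a + ρ * (z - a)) = g z := by
    filter_upwards [nhdsWithin_le_nhds h, nhdsWithin_le_nhds hev,
      nhdsWithin_le_nhds (hr.eventually hev), self_mem_nhdsWithin] with z h1 h2 h3 h4
    have h5 : (z - a) ^ n ≠ 0 := pow_ne_zero _ (sub_ne_zero.2 h4)
    rw [h1, h2] at h3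
    simp only [smul_eq_mul, add_sub_cancel_left, mul_pow] at h3
    apply mul_left_cancel₀ h5
    linear_combination -h3
  have hl1 : Tendsto (fun z => ρ ^ n * g (a + ρ * (z - a))) (𝓝[≠] a) (𝓝 (ρ ^ n * g a)) :=
    ((hg.continuousAt.tendsto.comp hr).const_mul _).mono_left nhdsWithin_le_nhds
  have hl2 : Tendsto g (𝓝[≠] a) (𝓝 (g a)) := hg.continuousAt.tendsto.mono_left nhdsWithin_le_nhds
  have := tendsto_nhds_unique (hl1.congr' hkey) hl2
  exact hρ n hn (mul_right_cancel₀ hga (by rw [this, one_mul]))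

/-- Real analytic functions on starlike sets that agree near the centre agree along rays. -/
theorem eq_of_eq_near_centre {S : Set ℂ} {a z : ℂ} {f g : ℂ → ℝ} {r : ℝ} (hr : 0 < r)
    (hf : AnalyticOnNhd ℝ f S) (hg : AnalyticOnNhd ℝ g S)
    (hS : ∀ t : ℝ, 0 < t → t ≤ 1 → a + t * (z - a) ∈ S)
    (hfg : ∀ t : ℝ, 0 < t → t ≤ 1 → a + t * (z - a) ∈ Metric.ball a r →
      f (a + t * (z - a)) = g (a + t * (z - a))) : f z = g z := by
  -- The parameter `t = 0` is left out because the centre need not belong to `S`, as for a cone and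
  -- its apex.
  have hA : AnalyticOnNhd ℝ (fun t : ℝ => f (a + t * (z - a)) - g (a + t * (z - a))) (Ioc 0 1) := by
    intro t ht
    have hp : AnalyticAt ℝ (fun t : ℝ => a + t * (z - a)) t := by
      have : AnalyticAt ℝ (fun t : ℝ => (t : ℂ)) t := ofRealCLM.analyticAt t
      fun_prop
    exact (AnalyticAt.comp_of_eq (hf _ (hS t ht.1 ht.2)) hp rfl).sub
      (AnalyticAt.comp_of_eq (hg _ (hS t ht.1 ht.2)) hp rfl)
  have hc : Continuous fun t : ℝ => a + t * (z - a) := by fun_prop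
  have hev : ∀ᶠ t : ℝ in 𝓝[>] 0, a + t * (z - a) ∈ Metric.ball a r := by
    have : Tendsto (fun t : ℝ => a + t * (z - a)) (𝓝[>] 0) (𝓝 a) := by
      simpa using (hc.tendsto 0).mono_left nhdsWithin_le_nhds
    exact this.eventually (Metric.ball_mem_nhds a hr)
  obtain ⟨t0, ht0, ht01⟩ := (hev.and (Ioo_mem_nhdsGT one_pos)).exists
  have := hA.eqOn_zero_of_preconnected_of_eventuallyEq_zero isPreconnected_Ioc
    (z₀ := t0) ⟨ht01.1, ht01.2.le⟩ (by
      filter_upwards [hc.continuousAt.eventually (Metric.isOpen_ball.mem_nhds ht0),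
        Ioo_mem_nhds ht01.1 ht01.2] with t h1 h2
      simp [hfg t h2.1 h2.2.le h1]) (x := 1) ⟨one_pos, le_rfl⟩
  simpa [sub_eq_zero] using this

theorem HarmonicOnNhd_analytic {f : ℂ → ℝ} {S : Set ℂ} (h : HarmonicOnNhd f S) :
    AnalyticOnNhd ℝ f S := fun z hz => HarmonicAt.analyticAt (h z hz)

/-- Harmonic functions on open sets that are starlike with respect to `a` and that agree near `a`
can be glued. -/
theorem exists_harmonic_glue {ι : Type*} (S : ι → Set ℂ) (h : ι → ℂ → ℝ) {a : ℂ} {r : ℝ}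
    (hr : 0 < r) (v : ℂ → ℝ) (hopen : ∀ i, IsOpen (S i)) (hh : ∀ i, HarmonicOnNhd (h i) (S i))
    (hstar : ∀ i, ∀ z ∈ S i, ∀ t : ℝ, 0 < t → t ≤ 1 → a + t * (z - a) ∈ S i)
    (hv : ∀ i, ∀ z ∈ S i, z ∈ Metric.ball a r → h i z = v z) :
    ∃ w : ℂ → ℝ, ∀ i, HarmonicOnNhd w (S i) ∧ EqOn w (h i) (S i) := by
  classical
  let w : ℂ → ℝ := fun z => if hz : ∃ i, z ∈ S i then h hz.choose z else 0
  have hw : ∀ i, EqOn w (h i) (S i) := by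
    intro i z hz
    have hex : ∃ i, z ∈ S i := ⟨i, hz⟩
    have hj := hex.choose_spec
    simp only [w, dif_pos hex]
    -- Comparing two pieces along the ray to `a` avoids any question of whether their overlap is
    -- connected.
    refine eq_of_eq_near_centre (S := S i ∩ S hex.choose) hr
      (HarmonicOnNhd_analytic ((hh _).mono inter_subset_right))
      (HarmonicOnNhd_analytic ((hh _).mono inter_subset_left))
      (fun t h0 h1 => ⟨hstar _ _ hz t h0 h1, hstar _ _ hj t h0 h1⟩) fun t h0 h1 hb => ?_
    rw [hv _ _ (hstar _ _ hz t h0 h1) hb, hv _ _ (hstar _ _ hj t h0 h1) hb]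
  refine ⟨w, fun i => ⟨fun z hz => ?_, hw i⟩⟩
  refine (harmonicAt_congr_nhds ?_).2 (hh i z hz)
  filter_upwards [(hopen i).mem_nhds hz] with y hy using hw i hy

/-- Maximum principle: a harmonic function vanishing on the boundary of a compact set vanishes
in the interior. -/
theorem harmonic_eq_zero_of_frontier {K : Set ℂ} {a : ℂ} {R : ℝ} (hK : IsClosed K)
    (hKR : K ⊆ Metric.ball a R)
    {w : ℂ → ℝ} (hw : HarmonicOnNhd w (Metric.ball a R)) (h0 : ∀ z ∈ frontier K, w z = 0) :
    ∀ z ∈ interior K, w z = 0 := by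
  obtain ⟨F, hF, hFw⟩ := hw.exists_analyticOnNhd_ball_re_eq
  have hcl : closure (interior K) ⊆ K := hK.closure_subset_iff.2 interior_subset
  have hb : Bornology.IsBounded (interior K) :=
    Metric.isBounded_ball.subset (interior_subset.trans hKR)
  -- Used for `s = 1` and `s = -1`: the maximum modulus principle for `exp (s F)`, whose modulus is
  -- `exp (s w)`, bounds `w` from above and below.
  have key : ∀ s : ℂ, s.im = 0 → ∀ z ∈ interior K, s.re * w z ≤ 0 := by
    intro s hs z hz
    have hd : DiffContOnCl ℂ (fun z => cexp (s * F z)) (interior K) := by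
      refine DifferentiableOn.diffContOnCl fun y hy => ?_
      have := (hF y (hKR (hcl hy))).differentiableAt
      exact (by fun_prop : DifferentiableAt ℂ (fun z => cexp (s * F z)) y).differentiableWithinAt
    have hn : ∀ y ∈ K, ‖cexp (s * F y)‖ = Real.exp (s.re * w y) := by
      intro y hy
      rw [norm_exp, mul_re, hs, ← hFw (hKR hy)]
      simp
    have := norm_le_of_forall_mem_frontier_norm_le hb hd (C := 1) (fun y hy => by
      have hyK : y ∈ frontier K := frontier_interior_subset hy
      rw [hn y (hK.frontier_subset hyK), h0 y hyK]
      simp) (subset_closure hz)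
    rw [hn z (interior_subset hz)] at this
    simpa using this
  intro z hz
  have h1 := key 1 (by simp) z hz
  have h2 := key (-1) (by simp) z hz
  simp at h1 h2
  linarith

end

/-! ### Extension by reflection and unique continuation around a cone. -/

noncomputable section

open InnerProductSpace Complex

open scoped ComplexConjugate

/-- The complement of the closed convex cone with apex `a` spanned by `e₁` and `e₂`. -/
def outerCone (a e₁ e₂ : ℂ) : Set ℂ :=
  {z | (conj e₁ * (z - a)).im < 0 ∨ 0 < (conj e₂ * (z - a)).im}

theorem isOpen_outerCone (a e₁ e₂ : ℂ) : IsOpen (outerCone a e₁ e₂) := by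
  rw [outerCone, ofPred_or]
  refine IsOpen.union (isOpen_lt ?_ continuous_const) (isOpen_lt continuous_const ?_) <;>
  exact continuous_im.comp (by fun_prop)

theorem ray_mem_outerCone {a e₁ e₂ z : ℂ} (hz : z ∈ outerCone a e₁ e₂) {t : ℝ} (ht : 0 < t) :
    a + t * (z - a) ∈ outerCone a e₁ e₂ := by
  have h : ∀ e : ℂ, (conj e * (a + t * (z - a) - a)).im = t * (conj e * (z - a)).im := by
    intro e
    rw [add_sub_cancel_left, mul_left_comm, im_ofReal_mul]
  simp only [outerCone, mem_ofPred_eq, h] at hz ⊢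
  rcases hz with hz | hz
  · exact Or.inl (mul_neg_of_pos_of_neg ht hz)
  · exact Or.inr (mul_pos ht hz)

theorem sub_mul_I_mem_outerCone {a e₁ e₂ : ℂ} (he : e₁ ≠ 0) {t : ℝ} (ht : 0 < t) :
    a + t * (-I * e₁) ∈ outerCone a e₁ e₂ := by
  left
  have : (conj e₁ * (a + t * (-I * e₁) - a)) = -((t * normSq e₁ : ℝ) : ℂ) * I := by
    rw [ofReal_mul, normSq_eq_conj_mul_self]
    ring
  rw [this]
  simp only [neg_mul, neg_im, mul_I_im, ofReal_re, Left.neg_neg_iff]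
  exact mul_pos ht (normSq_pos.2 he)

theorem im_conj_mul_reflect {a e c : ℂ} (hce : c * conj e = e) (z : ℂ) :
    (conj e * (reflect a c z - a)).im = -(conj e * (z - a)).im := by
  rw [reflect_sub, ← mul_assoc, mul_comm (conj e) c, hce, ← conj_im]
  simp

/-- The exterior of a convex cone and its reflections in the sides of the cone cover the punctured
plane. -/
theorem outerCone_cover {a e₁ e₂ c₁ c₂ z : ℂ} (hcross : 0 < (conj e₁ * e₂).im)
    (h₁ : c₁ * conj e₁ = e₁) (h₂ : c₂ * conj e₂ = e₂) (hz : z ≠ a) :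
    z ∈ outerCone a e₁ e₂ ∨ reflect a c₁ z ∈ outerCone a e₁ e₂ ∨
      reflect a c₂ z ∈ outerCone a e₁ e₂ := by
  by_contra! hcon
  obtain ⟨k0, k1, k2⟩ := hcon
  simp only [outerCone, mem_ofPred_eq, not_or, not_lt] at k0 k1 k2
  rw [im_conj_mul_reflect h₁] at k1
  rw [im_conj_mul_reflect h₂] at k2
  have m1 : (conj e₁ * (z - a)).im = 0 := le_antisymm (by linarith [k1.1]) k0.1
  have m2 : (conj e₂ * (z - a)).im = 0 := le_antisymm k0.2 (by linarith [k2.2])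
  simp only [mul_im, conj_re, conj_im] at m1 m2 hcross
  apply hz
  rw [← sub_eq_zero]
  apply Complex.ext
  · have : (z - a).re * (e₁.re * e₂.im + -e₁.im * e₂.re) = 0 := by
      linear_combination e₂.re * m1 - e₁.re * m2
    exact (mul_eq_zero.1 this).resolve_right hcross.ne'
  · have : (z - a).im * (e₁.re * e₂.im + -e₁.im * e₂.re) = 0 := by
      linear_combination e₂.im * m1 - e₁.im * m2
    exact (mul_eq_zero.1 this).resolve_right hcross.ne'

theorem ray_mem_ball {a z : ℂ} {r : ℝ} (hz : z ∈ Metric.ball a r) {t : ℝ} (h0 : 0 < t)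
    (h1 : t ≤ 1) : a + t * (z - a) ∈ Metric.ball a r := by
  rw [mem_ball_iff_norm] at *
  rw [add_sub_cancel_left, norm_mul, norm_real, Real.norm_of_nonneg h0.le]
  nlinarith [norm_nonneg (z - a)]

/-- A function that is harmonic in the exterior of a convex cone and that near the apex extends
to a harmonic function which is odd with respect to both sides of the cone extends to a full
ball. -/
theorem exists_harmonic_extension {a e₁ e₂ c₁ c₂ : ℂ} {r R : ℝ} (hr : 0 < r)
    (hcross : 0 < (conj e₁ * e₂).im)
    (h₁ : c₁ * conj e₁ = e₁) (h₂ : c₂ * conj e₂ = e₂) (hc₁ : ‖c₁‖ = 1) (hc₂ : ‖c₂‖ = 1)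
    {u v : ℂ → ℝ} (hu : HarmonicOnNhd u (outerCone a e₁ e₂ ∩ Metric.ball a R))
    (hv : HarmonicOnNhd v (Metric.ball a r))
    (huv : ∀ z ∈ outerCone a e₁ e₂, z ∈ Metric.ball a r → u z = v z)
    (ho₁ : ∀ z ∈ Metric.ball a r, v (reflect a c₁ z) = -v z)
    (ho₂ : ∀ z ∈ Metric.ball a r, v (reflect a c₂ z) = -v z) :
    ∃ w : ℂ → ℝ, HarmonicOnNhd w (Metric.ball a R) ∧
      EqOn w u (outerCone a e₁ e₂ ∩ Metric.ball a R) := by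
  have hW := isOpen_outerCone a e₁ e₂
  have hrefl : ∀ c : ℂ, ‖c‖ = 1 → HarmonicOnNhd (-fun z => u (reflect a c z))
      (reflect a c ⁻¹' outerCone a e₁ e₂ ∩ Metric.ball a R) := fun c hc z hz =>
    (harmonicAt_comp_reflect hc (hu _ ⟨hz.1, reflect_mem_ball hc hz.2⟩)).neg
  have hstar : ∀ c : ℂ, ∀ z ∈ reflect a c ⁻¹' outerCone a e₁ e₂ ∩ Metric.ball a R,
      ∀ t : ℝ, 0 < t → t ≤ 1 →
        a + t * (z - a) ∈ reflect a c ⁻¹' outerCone a e₁ e₂ ∩ Metric.ball a R := by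
    intro c z hz t h0 h1
    refine ⟨?_, ray_mem_ball hz.2 h0 h1⟩
    rw [mem_preimage, reflect_ray]
    exact ray_mem_outerCone hz.1 h0
  have hagree : ∀ c : ℂ, ‖c‖ = 1 → (∀ z ∈ Metric.ball a r, v (reflect a c z) = -v z) →
      ∀ z ∈ reflect a c ⁻¹' outerCone a e₁ e₂ ∩ Metric.ball a R, z ∈ Metric.ball a r →
        (-fun z => u (reflect a c z)) z = v z := by
    intro c hc ho z hz hzr
    rw [Pi.neg_apply, huv _ hz.1 (reflect_mem_ball hc hzr), ho z hzr, neg_neg]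
  obtain ⟨w, hw⟩ := exists_harmonic_glue (a := a)
    ![Metric.ball a r, outerCone a e₁ e₂ ∩ Metric.ball a R,
      reflect a c₁ ⁻¹' outerCone a e₁ e₂ ∩ Metric.ball a R,
      reflect a c₂ ⁻¹' outerCone a e₁ e₂ ∩ Metric.ball a R]
    ![v, u, -fun z => u (reflect a c₁ z), -fun z => u (reflect a c₂ z)] hr v
    (by
      simp only [Fin.forall_fin_succ, Fin.isValue, IsEmpty.forall_iff, and_true]
      exact ⟨Metric.isOpen_ball, hW.inter Metric.isOpen_ball,
        (hW.preimage (continuous_reflect a c₁)).inter Metric.isOpen_ball,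
        (hW.preimage (continuous_reflect a c₂)).inter Metric.isOpen_ball⟩)
    (by
      simp only [Fin.forall_fin_succ, Fin.isValue, IsEmpty.forall_iff, and_true]
      exact ⟨hv, hu, hrefl c₁ hc₁, hrefl c₂ hc₂⟩)
    (by
      simp only [Fin.forall_fin_succ, Fin.isValue, IsEmpty.forall_iff, and_true]
      exact ⟨fun z hz t h0 h1 => ray_mem_ball hz h0 h1,
        fun z hz t h0 h1 => ⟨ray_mem_outerCone hz.1 h0, ray_mem_ball hz.2 h0 h1⟩,
        hstar c₁, hstar c₂⟩)
    (by
      simp only [Fin.forall_fin_succ, Fin.isValue, IsEmpty.forall_iff, and_true]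
      exact ⟨fun _ _ _ => rfl, fun z hz hzr => huv z hz.1 hzr, hagree c₁ hc₁ ho₁,
        hagree c₂ hc₂ ho₂⟩)
  refine ⟨w, fun z hz => ?_, (hw 1).2⟩
  -- The small ball is needed for the apex only; the cone exterior and its two mirror images cover
  -- every other point.
  by_cases hza : z = a
  · exact (hw 0).1 z (by rw [hza]; exact Metric.mem_ball_self hr)
  rcases outerCone_cover hcross h₁ h₂ hza with h | h | h
  · exact (hw 1).1 z ⟨h, hz⟩
  · exact (hw 2).1 z ⟨h, hz⟩
  · exact (hw 3).1 z ⟨h, hz⟩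

/-- Unique continuation in the complement of a convex set `K` in a ball around a point of `K`. -/
theorem eqOn_ball_diff_convex {K : Set ℂ} (hK : Convex ℝ K) {a e₁ e₂ : ℂ} (ha : a ∈ K)
    (he : e₁ ≠ 0) {d R : ℝ} (hdR : d < R) (hKd : K ⊆ Metric.closedBall a d) {u w : ℂ → ℝ}
    (hu : HarmonicOnNhd u (Metric.ball a R \ K)) (hw : HarmonicOnNhd w (Metric.ball a R))
    (huw : EqOn w u (outerCone a e₁ e₂ ∩ Metric.ball a R)) :
    EqOn w u (Metric.ball a R \ K) := by
  have hD : AnalyticOnNhd ℝ (fun z => w z - u z) (Metric.ball a R \ K) := fun z hz =>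
    (HarmonicOnNhd_analytic hw z hz.1).sub (HarmonicOnNhd_analytic hu z hz)
  -- On the annulus outside `K`, the circle about `a` through `z` avoids `K` and meets the outer
  -- cone, so the identity theorem applies in the angle variable.
  have hann : ∀ z, d < ‖z - a‖ → ‖z - a‖ < R → w z = u z := by
    intro z hzd hzR
    have hd : 0 ≤ d := dist_nonneg.trans (hKd ha)
    have hza : z - a ≠ 0 := norm_pos_iff.1 (hd.trans_lt hzd)
    have hmem : ∀ t : ℝ, a + cexp (t * I) * (z - a) ∈ Metric.ball a R \ K := by
      intro t
      have hn : ‖a + cexp (t * I) * (z - a) - a‖ = ‖z - a‖ := by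
        rw [add_sub_cancel_left, norm_mul, norm_exp_ofReal_mul_I, one_mul]
      refine ⟨by rwa [mem_ball_iff_norm, hn], fun hmem => ?_⟩
      have := hKd hmem
      rw [mem_closedBall_iff_norm, hn] at this
      linarith
    have hp : ∀ t : ℝ, AnalyticAt ℝ (fun t : ℝ => a + cexp (t * I) * (z - a)) t := by
      intro t
      have h1 : AnalyticAt ℝ (fun t : ℝ => (t : ℂ)) t := ofRealCLM.analyticAt t
      have h2 : AnalyticAt ℝ cexp ((t : ℂ) * I) := analyticAt_cexp.restrictScalars
      have h3 : AnalyticAt ℝ (fun t : ℝ => cexp (t * I)) t :=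
        AnalyticAt.comp_of_eq h2 (h1.mul analyticAt_const) rfl
      exact analyticAt_const.add (h3.mul analyticAt_const)
    have hA : AnalyticOnNhd ℝ (fun t : ℝ => w (a + cexp (t * I) * (z - a)) -
        u (a + cexp (t * I) * (z - a))) univ := fun t _ =>
      AnalyticAt.comp_of_eq (hD _ (hmem t)) (hp t) rfl
    let s : ℝ := ‖z - a‖ / ‖e₁‖
    have hs : 0 < s := div_pos (norm_pos_iff.2 hza) (norm_pos_iff.2 he)
    -- The unimodular factor that rotates `z - a` onto the direction `-I * e₁`, which points into
    -- the outer cone.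
    let k : ℂ := s * (-I * e₁) / (z - a)
    have hk : ‖k‖ = 1 := by
      simp only [k, s, norm_div, norm_mul, norm_neg, norm_I, one_mul, norm_real, norm_norm]
      have := norm_pos_iff.2 he
      have := norm_pos_iff.2 hza
      field_simp
    have hk' : cexp (k.arg * I) = k := by
      have := norm_mul_exp_arg_mul_I k
      rwa [hk, ofReal_one, one_mul] at this
    have hW : a + cexp (k.arg * I) * (z - a) ∈ outerCone a e₁ e₂ := by
      rw [hk', div_mul_cancel₀ _ hza]
      exact sub_mul_I_mem_outerCone he hs
    have := hA.eqOn_zero_of_preconnected_of_eventuallyEq_zero isPreconnected_univ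
      (mem_univ k.arg) (by
        filter_upwards [(hp k.arg).continuousAt.eventually
          ((isOpen_outerCone a e₁ e₂).mem_nhds hW)] with t ht
        simp [huw ⟨ht, (hmem t).1⟩]) (mem_univ (0 : ℝ))
    simpa [sub_eq_zero] using this
  intro z hz
  have hza : z - a ≠ 0 := fun h => hz.2 (by rwa [sub_eq_zero.1 h])
  have hpos := norm_pos_iff.2 hza
  have hzR : ‖z - a‖ < R := mem_ball_iff_norm.1 hz.1
  by_cases hzd : d < ‖z - a‖
  · exact hann z hzd hzR
  push Not at hzd
  have hn : ∀ t : ℝ, 1 ≤ t → ‖a + t * (z - a) - a‖ = t * ‖z - a‖ := by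
    intro t ht
    rw [add_sub_cancel_left, norm_mul, norm_real, Real.norm_of_nonneg (by linarith)]
  -- Moving radially outward from `z` never enters `K`: as `a ∈ K`, convexity would put `z` itself
  -- in `K`. The ray reaches the annulus, where equality is known.
  have hmem : ∀ t ∈ Ico (1 : ℝ) (R / ‖z - a‖), a + t * (z - a) ∈ Metric.ball a R \ K := by
    intro t ht
    refine ⟨?_, fun hmem => hz.2 ?_⟩
    · rw [mem_ball_iff_norm, hn t ht.1]
      exact (lt_div_iff₀ hpos).1 ht.2
    · have ht0 : (0 : ℝ) < t := by linarith [ht.1]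
      have := hK.add_smul_sub_mem ha hmem (t := t⁻¹)
        ⟨by positivity, inv_le_one_of_one_le₀ ht.1⟩
      rw [add_sub_cancel_left, real_smul, ← mul_assoc, ← ofReal_mul, inv_mul_cancel₀ ht0.ne'] at this
      simpa using this
  have hA : AnalyticOnNhd ℝ (fun t : ℝ => w (a + t * (z - a)) - u (a + t * (z - a)))
      (Ico 1 (R / ‖z - a‖)) := by
    intro t ht
    have hp : AnalyticAt ℝ (fun t : ℝ => a + t * (z - a)) t := by
      have : AnalyticAt ℝ (fun t : ℝ => (t : ℂ)) t := ofRealCLM.analyticAt t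
      fun_prop
    exact AnalyticAt.comp_of_eq (hD _ (hmem t ht)) hp rfl
  obtain ⟨t₀, ht₀, ht₀'⟩ := exists_between ((div_lt_div_iff_of_pos_right hpos).2 hdR)
  have hd1 : 1 ≤ d / ‖z - a‖ := (one_le_div hpos).2 hzd
  have := hA.eqOn_zero_of_preconnected_of_eventuallyEq_zero isPreconnected_Ico
    (z₀ := t₀) ⟨by linarith, ht₀'⟩ (by
      filter_upwards [Ioo_mem_nhds ht₀ ht₀'] with t ht
      have h1 : 1 ≤ t := by linarith [ht.1]
      simp only [Pi.zero_apply, sub_eq_zero]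
      refine hann _ ?_ ?_
      · rw [hn t h1]
        exact (div_lt_iff₀ hpos).1 ht.1
      · rw [hn t h1]
        exact (lt_div_iff₀ hpos).1 ht.2) (x := 1) ⟨le_rfl, (one_lt_div hpos).2 hzR⟩
  simpa [sub_eq_zero] using this

/-! ### The local theorem at a corner. -/

/-- The Laplacian of a real analytic function is real analytic. -/
theorem AnalyticOnNhd_laplacian {v : ℂ → ℝ} {V : Set ℂ} (hv : AnalyticOnNhd ℝ v V) :
    AnalyticOnNhd ℝ (Laplacian.laplacian v) V := by
  rw [laplacian_eq_iteratedFDeriv_complexPlane]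
  have h := hv.iteratedFDeriv 2
  have happ : ∀ m : Fin 2 → ℂ, AnalyticOnNhd ℝ (fun x => iteratedFDeriv ℝ 2 v x m) V :=
    fun m x hx => ((ContinuousMultilinearMap.apply ℝ (fun _ : Fin 2 => ℂ) ℝ m).analyticAt _).comp
      (h x hx)
  exact fun x hx => (happ _ x hx).add (happ _ x hx)

/-- The Laplacian of `v` is real analytic and vanishes near one point of a connected ball, so the
identity theorem makes it vanish throughout. -/
theorem harmonicOnNhd_ball_of_analytic {a z : ℂ} {r : ℝ} {u v : ℂ → ℝ}
    (hv : AnalyticOnNhd ℝ v (Metric.ball a r)) (hz : z ∈ Metric.ball a r) (hu : HarmonicAt u z)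
    (huv : v =ᶠ[𝓝 z] u) : HarmonicOnNhd v (Metric.ball a r) := by
  have h0 := (AnalyticOnNhd_laplacian hv).eqOn_zero_of_preconnected_of_eventuallyEq_zero
    (convex_ball a r).isPreconnected hz ((laplacian_congr_nhds huv).trans hu.2)
  refine fun x hx => ⟨(hv x hx).contDiffAt, ?_⟩
  filter_upwards [Metric.isOpen_ball.mem_nhds hx] with y hy using h0 hy

/-- Let `u` be harmonic outside a compact convex set `K` with a corner at `a`, and suppose that `u`
vanishes on `∂K` and has an analytic continuation across `a`. Then `u = 0` if the angle at `a` is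
an irrational multiple of `π`, or if `u` is harmonic in the complement of `K` in a ball that is
centred at `a` and contains `K`. -/
theorem harmonic_eq_zero_of_analytic_continuation {U K V : Set ℂ}
    (hUc : IsPreconnected U) {u v : ℂ → ℝ}
    (hu : HarmonicOnNhd u U) (hK : IsClosed K) (hKc : Convex ℝ K) (hKi : (interior K).Nonempty)
    {a e₁ e₂ : ℂ} (ha : a ∈ K)
    (hnear : ∀ᶠ z in 𝓝 a, z ∉ K → z ∈ U)
    (hcross : 0 < (conj e₁ * e₂).im) (hcone : Disjoint (outerCone a e₁ e₂) K)
    (hs₁ : ∀ t : ℝ, 0 < t → t < 1 → a + t * e₁ ∈ frontier K)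
    (hs₂ : ∀ t : ℝ, 0 < t → t < 1 → a + t * e₂ ∈ frontier K)
    (htr : ∀ x ∈ frontier K, ∀ (N : Set ℂ) (w : ℂ → ℝ), IsOpen N → x ∈ N → ContinuousOn w N →
      EqOn w u (N ∩ U) → w x = 0)
    (hVo : IsOpen V) (haV : a ∈ V) (hv : AnalyticOnNhd ℝ v V) (hvu : EqOn v u (V ∩ U))
    (hcase : (∀ n : ℕ, 0 < n → ((conj e₁ * e₂) ^ n).im ≠ 0) ∨
      ∃ d R : ℝ, d < R ∧ K ⊆ Metric.closedBall a d ∧ Metric.ball a R \ K = Metric.ball a R ∩ U) :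
    EqOn u 0 U := by
  have he₁ : e₁ ≠ 0 := by rintro rfl; simp at hcross
  have he₂ : e₂ ≠ 0 := by rintro rfl; simp at hcross
  have hW := isOpen_outerCone a e₁ e₂
  have hWK : ∀ z ∈ outerCone a e₁ e₂, z ∉ K := fun z hz hzK => hcone.le_bot ⟨hz, hzK⟩
  have huA := HarmonicOnNhd_analytic hu
  obtain ⟨r, hr, hrV⟩ := Metric.mem_nhds_iff.1 (inter_mem (hVo.mem_nhds haV) hnear)
  have hrU : ∀ z ∈ outerCone a e₁ e₂, z ∈ Metric.ball a r → z ∈ U := fun z hz hzr =>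
    (hrV hzr).2 (hWK z hz)
  have hwit : ∀ ρ : ℝ, 0 < ρ → ∃ z ∈ outerCone a e₁ e₂, z ∈ Metric.ball a ρ := by
    intro ρ hρ
    have hI : 0 < ‖e₁‖ := norm_pos_iff.2 he₁
    refine ⟨_, sub_mul_I_mem_outerCone (e₂ := e₂) he₁ (t := ρ / (2 * ‖e₁‖)) (by positivity), ?_⟩
    rw [mem_ball_iff_norm, add_sub_cancel_left, norm_mul, norm_mul, norm_neg, norm_I, one_mul,
      norm_real, Real.norm_of_nonneg (by positivity)]
    field_simp
    linarith
  have hzero : ∀ z ∈ U, u =ᶠ[𝓝 z] 0 → EqOn u 0 U := fun z hz h =>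
    huA.eqOn_zero_of_preconnected_of_eventuallyEq_zero hUc hz h
  obtain ⟨z₀, hz₀W, hz₀r⟩ := hwit r hr
  have hvr : AnalyticOnNhd ℝ v (Metric.ball a r) := fun z hz => hv z (hrV hz).1
  have hvh : HarmonicOnNhd v (Metric.ball a r) := by
    refine harmonicOnNhd_ball_of_analytic hvr hz₀r (hu z₀ (hrU z₀ hz₀W hz₀r)) ?_
    filter_upwards [(hW.inter Metric.isOpen_ball).mem_nhds ⟨hz₀W, hz₀r⟩] with z hz
    exact hvu ⟨(hrV hz.2).1, hrU z hz.1 hz.2⟩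
  obtain ⟨F, hF, hFv⟩ := hvh.exists_analyticOnNhd_ball_re_eq
  have hvfr : ∀ x ∈ frontier K, x ∈ Metric.ball a r → v x = 0 := fun x hx hxr =>
    htr x hx _ v hVo (hrV hxr).1 hv.continuousOn hvu
  have hodd : ∀ e c : ℂ, e ≠ 0 → c * conj e = e → ‖c‖ = 1 →
      (∀ t : ℝ, 0 < t → t < 1 → a + t * e ∈ frontier K) → ∀ z ∈ Metric.ball a r,
      conj (F (reflect a c z)) = -F z := by
    intro e c he hce hc hs z hz
    have hpos := norm_pos_iff.2 he
    refine conj_comp_reflect_eq_neg (ε := min 1 (r / ‖e‖)) (by positivity) he hce hc hr hF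
      (fun t h0 h1 => ?_) hz
    have hb : a + t * e ∈ Metric.ball a r := by
      rw [mem_ball_iff_norm, add_sub_cancel_left, norm_mul, norm_real, Real.norm_of_nonneg h0.le]
      exact (lt_div_iff₀ hpos).1 (h1.trans_le (min_le_right _ _))
    exact (hFv hb).trans (hvfr _ (hs t h0 (h1.trans_le (min_le_left _ _))) hb)
  have hdir : ∀ e : ℂ, e ≠ 0 → e / conj e * conj e = e ∧ ‖e / conj e‖ = 1 := by
    intro e he
    have : conj e ≠ 0 := (map_ne_zero _).2 he
    refine ⟨div_mul_cancel₀ _ this, ?_⟩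
    rw [norm_div, RCLike.norm_conj, div_self (norm_ne_zero_iff.2 he)]
  obtain ⟨hc₁, hn₁⟩ := hdir e₁ he₁
  obtain ⟨hc₂, hn₂⟩ := hdir e₂ he₂
  have ho₁ := hodd e₁ _ he₁ hc₁ hn₁ hs₁
  have ho₂ := hodd e₂ _ he₂ hc₂ hn₂ hs₂
  rcases hcase with hirr | ⟨d, R, hdR, hKd, hBU⟩
  · have hconst := eventually_eq_const_of_rotation_invariant (F := F)
      (ρ := e₂ / conj e₂ * conj (e₁ / conj e₁)) (hF a (Metric.mem_ball_self hr)) (by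
        -- With `q = conj e₁ * e₂`, the product of the reflections is rotation by `q / conj q`, and
        -- `ρ ^ n = 1` says exactly that `q ^ n` is real.
        intro n hn h
        apply hirr n hn
        have h3 : conj e₂ ≠ 0 := (map_ne_zero _).2 he₂
        have h4 : e₂ / conj e₂ * conj (e₁ / conj e₁) =
            (conj e₁ * e₂) / conj (conj e₁ * e₂) := by
          simp only [map_div₀, map_mul, conj_conj]
          field_simp
        rw [h4, div_pow, div_eq_one_iff_eq, ← map_pow] at h
        · exact conj_eq_iff_im.1 h.symm
        · exact pow_ne_zero _ (by simp [he₁, he₂])) (by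
        filter_upwards [Metric.ball_mem_nhds a hr] with z hz
        have h1 := ho₁ z hz
        have h2 := ho₂ _ (reflect_mem_ball hn₁ hz)
        have h3 : reflect a (e₂ / conj e₂) (reflect a (e₁ / conj e₁) z) =
            a + e₂ / conj e₂ * conj (e₁ / conj e₁) * (z - a) := by
          rw [reflect, reflect_sub, map_mul, conj_conj]
          ring
        rw [h3] at h2
        apply (starRingEnd ℂ).injective
        rw [h2, ← conj_conj (F (reflect a (e₁ / conj e₁) z)), h1, map_neg, neg_neg])
    -- The centre is fixed by the reflection, so oddness there reads `conj (F a) = -F a`.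
    have hFa : (F a).re = 0 := by
      have := congrArg re (ho₁ a (Metric.mem_ball_self hr))
      simp [reflect] at this
      linarith
    obtain ⟨ρ, hρ, hρs⟩ := Metric.mem_nhds_iff.1 (hconst.and (Metric.ball_mem_nhds a hr))
    obtain ⟨z₁, hz₁W, hz₁ρ⟩ := hwit ρ hρ
    refine hzero z₁ (hrU z₁ hz₁W (hρs hz₁ρ).2) ?_
    filter_upwards [(hW.inter Metric.isOpen_ball).mem_nhds ⟨hz₁W, hz₁ρ⟩] with z hz
    obtain ⟨h1, h2⟩ := hρs hz.2
    rw [← hvu ⟨(hrV h2).1, hrU z hz.1 h2⟩, ← hFv h2]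
    simp [h1, hFa]
  · have hWU : outerCone a e₁ e₂ ∩ Metric.ball a R ⊆ U := fun z hz =>
      (hBU ▸ ⟨hz.2, hWK z hz.1⟩ : z ∈ Metric.ball a R ∩ U).2
    have hd : 0 ≤ d := dist_nonneg.trans (hKd ha)
    have hR : 0 < R := hd.trans_lt hdR
    have hre : ∀ c, (∀ z ∈ Metric.ball a r, conj (F (reflect a c z)) = -F z) → ‖c‖ = 1 →
        ∀ z ∈ Metric.ball a r, v (reflect a c z) = -v z := by
      intro c h hc z hz
      rw [← hFv hz, ← hFv (reflect_mem_ball hc hz)]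
      simpa using congrArg re (h z hz)
    obtain ⟨w, hw, hwu⟩ := exists_harmonic_extension hr hcross hc₁ hc₂ hn₁ hn₂ (hu.mono hWU) hvh
      (fun z hz hzr => (hvu ⟨(hrV hzr).1, hrU z hz hzr⟩).symm)
      (hre _ ho₁ hn₁) (hre _ ho₂ hn₂)
    have hwu' := eqOn_ball_diff_convex hKc ha he₁ hdR hKd
      (hu.mono (by rw [hBU]; exact inter_subset_right)) hw hwu
    have hKR : K ⊆ Metric.ball a R := hKd.trans (Metric.closedBall_subset_ball hdR)
    have hw0 := harmonic_eq_zero_of_frontier hK hKR hw fun z hz =>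
      htr z hz _ w Metric.isOpen_ball (hKR (hK.frontier_subset hz)) hw.continuousOn
        (by rw [← hBU]; exact hwu')
    obtain ⟨y, hy⟩ := hKi
    -- Vanishing on the nonempty interior of `K` spreads to the whole ball, and thereby to the cone
    -- exterior, where `w = u`.
    have hwz := (HarmonicOnNhd_analytic hw).eqOn_zero_of_preconnected_of_eventuallyEq_zero
      (convex_ball a R).isPreconnected (hKR (interior_subset hy)) (by
        filter_upwards [isOpen_interior.mem_nhds hy] with z hz using hw0 z hz)
    obtain ⟨z₁, hz₁W, hz₁R⟩ := hwit R hR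
    refine hzero z₁ (hWU ⟨hz₁W, hz₁R⟩) ?_
    filter_upwards [(hW.inter Metric.isOpen_ball).mem_nhds ⟨hz₁W, hz₁R⟩] with z hz
    rw [← hwu hz, hwz hz.2]

end

/-! ### `L²` estimates on strips and their consequences for traces. -/

noncomputable section

open scoped ENNReal NNReal

theorem ENNReal_add_sq_le (a b : ℝ≥0∞) : (a + b) ^ 2 ≤ 2 * a ^ 2 + 2 * b ^ 2 := by
  have := ENNReal.rpow_add_le_mul_rpow_add_rpow a b (p := 2) one_le_two
  norm_num at this
  simpa [mul_add] using this

theorem eLpNorm_two_sq {α E : Type*} {m : MeasurableSpace α} {μ : Measure α}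
    [NormedAddCommGroup E] (f : α → E) : eLpNorm f 2 μ ^ 2 = ∫⁻ x, ‖f x‖ₑ ^ 2 ∂μ := by
  have := eLpNorm_nnreal_pow_eq_lintegral (μ := μ) (f := f) (p := 2) two_ne_zero
  simpa using this

/-- Cauchy–Schwarz against the constant function `1`. -/
theorem lintegral_sq_le {α : Type*} {m : MeasurableSpace α} {μ : Measure α} {f : α → ℝ}
    (hf : AEStronglyMeasurable f μ) :
    (∫⁻ x, ‖f x‖ₑ ∂μ) ^ 2 ≤ μ univ * ∫⁻ x, ‖f x‖ₑ ^ 2 ∂μ := by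
  have h := eLpNorm_le_eLpNorm_mul_rpow_measure_univ (p := 1) (q := 2) one_le_two hf
  have h2 := pow_le_pow_left₀ (zero_le) h 2
  rw [mul_pow, eLpNorm_two_sq, eLpNorm_one_eq_lintegral_enorm, mul_comm] at h2
  refine h2.trans (le_of_eq ?_)
  congr 1
  rw [← ENNReal.rpow_natCast, ← ENNReal.rpow_mul]
  norm_num

/-- One-dimensional comparison of the values of a `C¹` function at two points. -/
theorem enorm_sq_le_of_contDiff {h : ℝ → ℝ} (hh : ContDiff ℝ 1 h) {δ s t : ℝ}
    (hs : s ∈ Icc 0 δ) (ht : t ∈ Icc 0 δ) :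
    ‖h s‖ₑ ^ 2 ≤ 2 * ‖h t‖ₑ ^ 2 +
      2 * (ENNReal.ofReal δ * ∫⁻ r in Ioo 0 δ, ‖deriv h r‖ₑ ^ 2) := by
  have hc : Continuous (deriv h) := hh.continuous_deriv le_rfl
  have h1 : ‖h s - h t‖ₑ ≤ ∫⁻ r in Ioo 0 δ, ‖deriv h r‖ₑ := by
    rw [← intervalIntegral.integral_deriv_eq_sub (fun x _ => hh.differentiable one_ne_zero x)
      (hc.intervalIntegrable _ _), ← enorm_norm, intervalIntegral.norm_intervalIntegral_eq,
      enorm_norm]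
    refine (enorm_integral_le_lintegral_enorm _).trans ?_
    rw [Measure.restrict_congr_set Ioo_ae_eq_Ioc]
    refine lintegral_mono_set (Ioc_subset_Ioc ?_ ?_)
    · exact le_min ht.1 hs.1
    · exact max_le ht.2 hs.2
  have h2 : ‖h s - h t‖ₑ ^ 2 ≤ ENNReal.ofReal δ * ∫⁻ r in Ioo 0 δ, ‖deriv h r‖ₑ ^ 2 := by
    refine (pow_le_pow_left₀ zero_le h1 2).trans ?_
    refine (lintegral_sq_le hc.aestronglyMeasurable).trans (le_of_eq ?_)
    simp
  calc ‖h s‖ₑ ^ 2 = ‖h t + (h s - h t)‖ₑ ^ 2 := by congr 2; ring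
    _ ≤ (‖h t‖ₑ + ‖h s - h t‖ₑ) ^ 2 := pow_le_pow_left₀ zero_le (enorm_add_le _ _) 2
    _ ≤ 2 * ‖h t‖ₑ ^ 2 + 2 * ‖h s - h t‖ₑ ^ 2 := ENNReal_add_sq_le _ _
    _ ≤ _ := by gcongr

/-- A volume preserving parametrization of the plane by straight fibres over a curve. -/
structure IsStripChart (G : ℝ × ℝ → Plane) : Prop where
  measurePreserving : MeasurePreserving G volume volume
  continuous : Continuous G
  fibre : ∃ ν : Plane, ‖ν‖ = 1 ∧ ∀ x t, G (x, t) = G (x, 0) + t • ν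

theorem enorm_gradient (φ : Plane → ℝ) (x : Plane) : ‖gradient φ x‖ₑ = ‖fderiv ℝ φ x‖ₑ := by
  rw [gradient, LinearIsometryEquiv.enorm_map]

theorem continuous_gradient {φ : Plane → ℝ} (hφ : ContDiff ℝ ∞ φ) : Continuous (gradient φ) :=
  (LinearIsometryEquiv.continuous _).comp (hφ.continuous_fderiv (by simp))

namespace IsStripChart

variable {G : ℝ × ℝ → Plane} {φ : Plane → ℝ}

/-- The one-dimensional comparison along a fibre: the fibre direction is a unit vector, so the
derivative of `φ` along it is at most the gradient. -/
theorem enorm_sq_le (hG : IsStripChart G) (hφ : ContDiff ℝ ∞ φ) (x : ℝ) {δ s t : ℝ}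
    (hs : s ∈ Icc 0 δ) (ht : t ∈ Icc 0 δ) :
    ‖φ (G (x, s))‖ₑ ^ 2 ≤ 2 * ‖φ (G (x, t))‖ₑ ^ 2 +
      2 * (ENNReal.ofReal δ * ∫⁻ r in Ioo 0 δ, ‖gradient φ (G (x, r))‖ₑ ^ 2) := by
  obtain ⟨ν, hν, hf⟩ := hG.fibre
  have hline : ∀ r, HasDerivAt (fun r : ℝ => G (x, 0) + r • ν) ν r := fun r => by
    simpa using ((hasDerivAt_id r).smul_const ν).const_add (G (x, 0))
  have hG' : (fun r => φ (G (x, r))) = φ ∘ fun r : ℝ => G (x, 0) + r • ν := by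
    ext r
    simp [hf x r]
  have hc : ContDiff ℝ 1 (fun r => φ (G (x, r))) := by
    rw [hG']
    refine (hφ.of_le (by simp)).comp ?_
    fun_prop
  refine (enorm_sq_le_of_contDiff hc hs ht).trans ?_
  gcongr with r
  rw [enorm_gradient]
  have hd : deriv (fun r => φ (G (x, r))) r = fderiv ℝ φ (G (x, r)) ν := by
    rw [hG', hf x r]
    exact (((hφ.differentiable (by simp)) _).hasFDerivAt.comp_hasDerivAt r (hline r)).deriv
  rw [hd]
  refine (ContinuousLinearMap.le_opENorm _ _).trans ?_
  rw [← ofReal_norm ν, hν]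
  simp

theorem measurable_enorm_sq (hG : IsStripChart G) (hφ : ContDiff ℝ ∞ φ) :
    Measurable fun p => ‖φ (G p)‖ₑ ^ 2 :=
  ((hφ.continuous.comp hG.continuous).enorm.measurable).pow_const 2

theorem measurable_gradient (hG : IsStripChart G) (hφ : ContDiff ℝ ∞ φ) :
    Measurable fun p => ‖gradient φ (G p)‖ₑ ^ 2 :=
  (((continuous_gradient hφ).comp hG.continuous).enorm.measurable).pow_const 2

theorem lintegral_strip (I : Set ℝ) (δ : ℝ) {F : ℝ × ℝ → ℝ≥0∞} (hF : Measurable F) :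
    ∫⁻ p in I ×ˢ Ioo 0 δ, F p = ∫⁻ x in I, ∫⁻ t in Ioo 0 δ, F (x, t) := by
  rw [Measure.volume_eq_prod, ← Measure.prod_restrict, lintegral_prod _ hF.aemeasurable]

/-- Integrates the fibre comparison with the base point as reference. The factor `δ ^ 2` on the
gradient makes that term negligible against the area of a strip as `δ → 0`. -/
theorem lintegral_strip_le (hG : IsStripChart G) (hφ : ContDiff ℝ ∞ φ) (I : Set ℝ) {δ : ℝ}
    (hδ : 0 ≤ δ) :
    ∫⁻ p in I ×ˢ Ioo 0 δ, ‖φ (G p)‖ₑ ^ 2 ≤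
      2 * (ENNReal.ofReal δ * ∫⁻ x in I, ‖φ (G (x, 0))‖ₑ ^ 2) +
      2 * (ENNReal.ofReal δ ^ 2 * ∫⁻ p in I ×ˢ Ioo 0 δ, ‖gradient φ (G p)‖ₑ ^ 2) := by
  have hm0 : Measurable fun x : ℝ => ‖φ (G (x, 0))‖ₑ ^ 2 :=
    (hG.measurable_enorm_sq hφ).comp (by fun_prop)
  have hm1 : Measurable fun x : ℝ => ∫⁻ r in Ioo 0 δ, ‖gradient φ (G (x, r))‖ₑ ^ 2 :=
    (hG.measurable_gradient hφ).lintegral_prod_right'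
  rw [lintegral_strip I δ (hG.measurable_enorm_sq hφ),
    lintegral_strip I δ (hG.measurable_gradient hφ)]
  calc ∫⁻ x in I, ∫⁻ t in Ioo 0 δ, ‖φ (G (x, t))‖ₑ ^ 2
      ≤ ∫⁻ x in I, ∫⁻ _ in Ioo 0 δ, (2 * ‖φ (G (x, 0))‖ₑ ^ 2 +
          2 * (ENNReal.ofReal δ * ∫⁻ r in Ioo 0 δ, ‖gradient φ (G (x, r))‖ₑ ^ 2)) := by
        refine lintegral_mono fun x => setLIntegral_mono measurable_const fun t ht => ?_
        exact hG.enorm_sq_le hφ x ⟨ht.1.le, ht.2.le⟩ ⟨le_rfl, hδ⟩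
    _ = ∫⁻ x in I, (2 * ENNReal.ofReal δ * ‖φ (G (x, 0))‖ₑ ^ 2 +
          2 * ENNReal.ofReal δ ^ 2 * ∫⁻ r in Ioo 0 δ, ‖gradient φ (G (x, r))‖ₑ ^ 2) := by
        refine lintegral_congr fun x => ?_
        rw [setLIntegral_const, Real.volume_Ioo, sub_zero]
        ring
    _ = _ := by
        rw [lintegral_add_left (hm0.const_mul _), lintegral_const_mul _ hm0,
          lintegral_const_mul _ hm1]
        ring

/-- The reverse use of the fibre comparison, averaging over the strip: a trace inequality with
constants depending only on the width. -/
theorem lintegral_base_le (hG : IsStripChart G) (hφ : ContDiff ℝ ∞ φ) (I : Set ℝ) {δ : ℝ}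
    (hδ : 0 ≤ δ) :
    ENNReal.ofReal δ * ∫⁻ x in I, ‖φ (G (x, 0))‖ₑ ^ 2 ≤
      2 * (∫⁻ p in I ×ˢ Ioo 0 δ, ‖φ (G p)‖ₑ ^ 2) +
      2 * (ENNReal.ofReal δ ^ 2 * ∫⁻ p in I ×ˢ Ioo 0 δ, ‖gradient φ (G p)‖ₑ ^ 2) := by
  have hm0 : Measurable fun x : ℝ => ‖φ (G (x, 0))‖ₑ ^ 2 :=
    (hG.measurable_enorm_sq hφ).comp (by fun_prop)
  have hm1 : Measurable fun x : ℝ => ∫⁻ r in Ioo 0 δ, ‖gradient φ (G (x, r))‖ₑ ^ 2 :=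
    (hG.measurable_gradient hφ).lintegral_prod_right'
  have hm2 : ∀ x, Measurable fun t : ℝ => ‖φ (G (x, t))‖ₑ ^ 2 := fun x =>
    (hG.measurable_enorm_sq hφ).comp (by fun_prop)
  have hm3 : Measurable fun x : ℝ => ∫⁻ r in Ioo 0 δ, ‖φ (G (x, r))‖ₑ ^ 2 :=
    (hG.measurable_enorm_sq hφ).lintegral_prod_right'
  rw [lintegral_strip I δ (hG.measurable_enorm_sq hφ),
    lintegral_strip I δ (hG.measurable_gradient hφ)]
  calc ENNReal.ofReal δ * ∫⁻ x in I, ‖φ (G (x, 0))‖ₑ ^ 2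
      = ∫⁻ x in I, ∫⁻ _ in Ioo 0 δ, ‖φ (G (x, 0))‖ₑ ^ 2 := by
        rw [← lintegral_const_mul _ hm0]
        refine lintegral_congr fun x => ?_
        rw [setLIntegral_const, Real.volume_Ioo, sub_zero, mul_comm]
    _ ≤ ∫⁻ x in I, ∫⁻ t in Ioo 0 δ, (2 * ‖φ (G (x, t))‖ₑ ^ 2 +
          2 * (ENNReal.ofReal δ * ∫⁻ r in Ioo 0 δ, ‖gradient φ (G (x, r))‖ₑ ^ 2)) := by
        refine lintegral_mono fun x => setLIntegral_mono' measurableSet_Ioo fun t ht => ?_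
        exact hG.enorm_sq_le hφ x ⟨le_rfl, hδ⟩ ⟨ht.1.le, ht.2.le⟩
    _ = ∫⁻ x in I, (2 * ∫⁻ t in Ioo 0 δ, ‖φ (G (x, t))‖ₑ ^ 2) +
          2 * ENNReal.ofReal δ ^ 2 * ∫⁻ r in Ioo 0 δ, ‖gradient φ (G (x, r))‖ₑ ^ 2 := by
        refine lintegral_congr fun x => ?_
        rw [lintegral_add_right _ measurable_const, setLIntegral_const, Real.volume_Ioo, sub_zero,
          lintegral_const_mul _ (hm2 x)]
        ring
    _ = _ := by
        rw [lintegral_add_left (hm3.const_mul _), lintegral_const_mul _ hm3,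
          lintegral_const_mul _ hm1]
        ring

/-- `L²` norms over a strip are bounded by those over any set containing its image. -/
theorem lintegral_comp_le (hG : IsStripChart G) {E : Type*} [NormedAddCommGroup E]
    {U : Set Plane} (hU : MeasurableSet U) {S : Set (ℝ × ℝ)} (hS : ∀ p ∈ S, G p ∈ U)
    {F : Plane → E} (hF : AEStronglyMeasurable F (volume.restrict U)) :
    ∫⁻ p in S, ‖F (G p)‖ₑ ^ 2 ≤ eLpNorm F 2 (volume.restrict U) ^ 2 := by
  rw [← eLpNorm_comp_measurePreserving hF (hG.measurePreserving.restrict_preimage hU),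
    eLpNorm_two_sq]
  exact lintegral_mono_set hS

end IsStripChart

/-- If `u` has trace zero on a segment which is the base of a strip chart, then `|u|` is not
bounded below near the segment. -/
theorem not_bounded_below_of_trace_zero {U Γ : Set Plane} (hU : MeasurableSet U) {u : Plane → ℝ}
    (h : HasTrace U Γ u (fun _ => 0)) {G : ℝ × ℝ → Plane} (hG : IsStripChart G)
    (hiso : Isometry fun x => G (x, 0)) {α β δ₀ c : ℝ} (hαβ : α < β) (hδ₀ : 0 < δ₀) (hc : 0 < c)
    (hΓ : ∀ x ∈ Ioo α β, G (x, 0) ∈ Γ)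
    (hstrip : ∀ x ∈ Ioo α β, ∀ t ∈ Ioo 0 δ₀, G (x, t) ∈ U ∧ c ≤ |u (G (x, t))|) : False := by
  obtain ⟨-, -, φ, hφ, ⟨g, hg, hgrad, hu0, hg0⟩, ht⟩ := h
  have hum : AEStronglyMeasurable u (volume.restrict U) :=
    (hgrad.locallyIntegrable_fun).aestronglyMeasurable
  have hgm := hg.1
  set I := Ioo α β
  set M : ℝ≥0∞ := 1 + eLpNorm g 2 (volume.restrict U)
  have hM : M < ⊤ := ENNReal.add_lt_top.2 ⟨ENNReal.one_lt_top, hg.2⟩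
  have hgb : ∀ᶠ k in atTop, eLpNorm (gradient (φ k)) 2 (volume.restrict U) ≤ M := by
    filter_upwards [(hg0.eventually (ge_mem_nhds one_pos))] with k hk
    have : gradient (φ k) = (fun x => gradient (φ k) x - g x) + g := by ext x; simp
    rw [this]
    refine (eLpNorm_add_le ((continuous_gradient (hφ k)).aestronglyMeasurable.sub hgm) hgm
      one_le_two).trans (add_le_add hk le_rfl)
  have hbase : ∀ k, ∫⁻ x in I, ‖φ k (G (x, 0))‖ₑ ^ 2 ≤
      eLpNorm (fun x => φ k x - 0) 2 (arcLength Γ) ^ 2 := by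
    intro k
    have hmeas : Measurable fun x : ℝ => G (x, 0) := hiso.continuous.measurable
    -- An isometric base carries Lebesgue measure to one-dimensional Hausdorff measure on its image,
    -- which lies in `Γ`.
    have hle : (volume.restrict I).map (fun x => G (x, 0)) ≤ arcLength Γ := by
      refine Measure.le_iff.2 fun B hB => ?_
      rw [Measure.map_apply hmeas hB, arcLength, Measure.restrict_apply hB,
        Measure.restrict_apply (hmeas hB), ← hausdorffMeasure_real,
        ← hiso.hausdorffMeasure_image (Or.inl zero_le_one)]
      refine measure_mono ?_
      rintro _ ⟨x, hx, rfl⟩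
      exact ⟨hx.1, hΓ x hx.2⟩
    rw [eLpNorm_two_sq]
    simp only [sub_zero]
    refine le_trans (le_of_eq ?_) (lintegral_mono' hle le_rfl)
    rw [lintegral_map (((hφ k).continuous.enorm.measurable).pow_const 2) hmeas]
  -- The left side bounds the strip integral of `|u|²` from below. On the right, the base term and
  -- the `L²` error vanish in the limit `k → ∞`, leaving only the gradient term.
  have key : ∀ δ, 0 < δ → δ < δ₀ →
      ENNReal.ofReal c ^ 2 * (ENNReal.ofReal (β - α) * ENNReal.ofReal δ) ≤
        4 * (ENNReal.ofReal δ ^ 2 * M ^ 2) := by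
    intro δ h0 h1
    have hSU : ∀ p ∈ I ×ˢ Ioo 0 δ, G p ∈ U := fun p hp =>
      (hstrip p.1 hp.1 p.2 ⟨hp.2.1, hp.2.2.trans h1⟩).1
    have hlow : ∀ k, ENNReal.ofReal c ^ 2 * (ENNReal.ofReal (β - α) * ENNReal.ofReal δ) ≤
        2 * (∫⁻ p in I ×ˢ Ioo 0 δ, ‖φ k (G p)‖ₑ ^ 2) +
          2 * eLpNorm (fun x => φ k x - u x) 2 (volume.restrict U) ^ 2 := by
      intro k
      have hvol : volume (I ×ˢ Ioo 0 δ) = ENNReal.ofReal (β - α) * ENNReal.ofReal δ := by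
        rw [Measure.volume_eq_prod, Measure.prod_prod, Real.volume_Ioo, Real.volume_Ioo, sub_zero]
      rw [← hvol, ← setLIntegral_const]
      calc ∫⁻ _ in I ×ˢ Ioo 0 δ, ENNReal.ofReal c ^ 2
          ≤ ∫⁻ p in I ×ˢ Ioo 0 δ, (2 * ‖φ k (G p)‖ₑ ^ 2 +
              2 * ‖φ k (G p) - u (G p)‖ₑ ^ 2) := by
            refine setLIntegral_mono' (measurableSet_Ioo.prod measurableSet_Ioo) fun p hp => ?_
            refine le_trans (pow_le_pow_left₀ zero_le ?_ 2) (ENNReal_add_sq_le _ _)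
            have h2 : ENNReal.ofReal c ≤ ‖u (G p)‖ₑ := by
              rw [← ofReal_norm]
              exact ENNReal.ofReal_le_ofReal (hstrip p.1 hp.1 p.2 ⟨hp.2.1, hp.2.2.trans h1⟩).2
            refine h2.trans ?_
            calc ‖u (G p)‖ₑ = ‖φ k (G p) - (φ k (G p) - u (G p))‖ₑ := by congr 1; ring
              _ ≤ _ := enorm_sub_le
        _ = 2 * (∫⁻ p in I ×ˢ Ioo 0 δ, ‖φ k (G p)‖ₑ ^ 2) +
              2 * ∫⁻ p in I ×ˢ Ioo 0 δ, ‖φ k (G p) - u (G p)‖ₑ ^ 2 := by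
            rw [lintegral_add_left ((hG.measurable_enorm_sq (hφ k)).const_mul _),
              lintegral_const_mul _ (hG.measurable_enorm_sq (hφ k)),
              lintegral_const_mul' _ _ ENNReal.ofNat_ne_top]
        _ ≤ _ := by
            gcongr
            exact hG.lintegral_comp_le hU hSU
              ((hφ k).continuous.aestronglyMeasurable.sub hum)
    have hup : ∀ᶠ k in atTop,
        ENNReal.ofReal c ^ 2 * (ENNReal.ofReal (β - α) * ENNReal.ofReal δ) ≤
        2 * (2 * (ENNReal.ofReal δ * eLpNorm (fun x => φ k x - 0) 2 (arcLength Γ) ^ 2) +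
          2 * (ENNReal.ofReal δ ^ 2 * M ^ 2)) +
          2 * eLpNorm (fun x => φ k x - u x) 2 (volume.restrict U) ^ 2 := by
      filter_upwards [hgb] with k hk
      refine (hlow k).trans ?_
      gcongr
      refine (hG.lintegral_strip_le (hφ k) I h0.le).trans ?_
      gcongr
      · exact hbase k
      · refine (hG.lintegral_comp_le hU hSU
          (continuous_gradient (hφ k)).aestronglyMeasurable).trans ?_
        gcongr
    have hlim : Tendsto (fun k =>
        2 * (2 * (ENNReal.ofReal δ * eLpNorm (fun x => φ k x - 0) 2 (arcLength Γ) ^ 2) +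
          2 * (ENNReal.ofReal δ ^ 2 * M ^ 2)) +
          2 * eLpNorm (fun x => φ k x - u x) 2 (volume.restrict U) ^ 2) atTop
        (𝓝 (2 * (2 * (ENNReal.ofReal δ * 0 ^ 2) + 2 * (ENNReal.ofReal δ ^ 2 * M ^ 2)) +
          2 * 0 ^ 2)) := by
      refine Tendsto.add (ENNReal.Tendsto.const_mul (Tendsto.add (ENNReal.Tendsto.const_mul
        (ENNReal.Tendsto.const_mul (ENNReal.Tendsto.pow ht) ?_) ?_) tendsto_const_nhds) ?_)
        (ENNReal.Tendsto.const_mul (ENNReal.Tendsto.pow hu0) ?_) <;> right <;> simp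
    refine (ge_of_tendsto hlim hup).trans (le_of_eq ?_)
    simp only [ne_eq, OfNat.ofNat_ne_zero, not_false_eq_true, zero_pow, mul_zero, zero_add,
      add_zero]
    ring
  lift M to ℝ≥0 using hM.ne with m hm
  have key' : ∀ δ, 0 < δ → δ < δ₀ → c ^ 2 * (β - α) ≤ 4 * δ * m ^ 2 := by
    intro δ h0 h1
    have h2 := key δ h0 h1
    have hba : 0 ≤ β - α := by linarith
    rw [← ENNReal.ofReal_coe_nnreal, ← ENNReal.ofReal_pow hc.le, ← ENNReal.ofReal_mul hba,
      ← ENNReal.ofReal_mul (by positivity), ← ENNReal.ofReal_pow h0.le,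
      ← ENNReal.ofReal_pow m.coe_nonneg, ← ENNReal.ofReal_mul (by positivity),
      show (4 : ℝ≥0∞) = ENNReal.ofReal 4 by simp, ← ENNReal.ofReal_mul (by positivity),
      ENNReal.ofReal_le_ofReal_iff (by positivity)] at h2
    refine le_of_mul_le_mul_right ?_ h0
    linarith
  have hlim : Tendsto (fun δ : ℝ => 4 * δ * (m : ℝ) ^ 2) (𝓝[>] 0) (𝓝 0) := by
    have : Continuous fun δ : ℝ => 4 * δ * (m : ℝ) ^ 2 := by fun_prop
    simpa using (this.tendsto 0).mono_left nhdsWithin_le_nhds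
  have : c ^ 2 * (β - α) ≤ 0 := by
    refine ge_of_tendsto hlim ?_
    filter_upwards [Ioo_mem_nhdsGT hδ₀] with δ hδ using key' δ hδ.1 hδ.2
  have h2 : 0 < c ^ 2 * (β - α) := mul_pos (by positivity) (by linarith)
  linarith

/-- The weak gradient of a function that vanishes on an open set vanishes almost everywhere. -/
theorem IsWeakGradient_ae_eq_zero {U : Set Plane} (hU : IsOpen U) {u : Plane → ℝ}
    {g : Plane → Plane} (h : IsWeakGradient U u g) (hu : EqOn u 0 U) :
    g =ᵐ[volume.restrict U] 0 := by
  rw [EventuallyEq, ae_restrict_iff' hU.measurableSet]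
  refine hU.ae_eq_zero_of_integral_contDiff_smul_eq_zero h.locallyIntegrable_grad ?_
  intro ψ hψ hψc hψU
  have h1 := h.integral_eq ψ hψ hψc hψU
  rw [setIntegral_congr_fun hU.measurableSet (g := fun _ => (0 : Plane))
    (fun x hx => by simp [hu hx]), integral_zero, zero_eq_neg] at h1
  rwa [setIntegral_eq_integral_of_forall_compl_eq_zero] at h1
  intro x hx
  rw [image_eq_zero_of_notMem_tsupport fun h => hx (hψU h), zero_smul]

/-- The trace of the zero function vanishes on every piece of curve that is the base of a strip. -/
theorem trace_ae_eq_zero_of_strip {U Γ N : Set Plane} (hU : IsOpen U) {u f : Plane → ℝ}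
    (hu : EqOn u 0 U) (h : HasTrace U Γ u f) {G : ℝ × ℝ → Plane} (hG : IsStripChart G)
    {I : Set ℝ} {L : ℝ≥0} (hL : LipschitzOnWith L (fun x => G (x, 0)) I) {δ : ℝ} (hδ : 0 < δ)
    (hN : MeasurableSet N)
    (hNΓ : ∀ y ∈ N ∩ Γ, ∃ x ∈ I, G (x, 0) = y)
    (hstrip : ∀ x ∈ I, ∀ t ∈ Ioo 0 δ, G (x, t) ∈ U) :
    arcLength Γ (N ∩ {y | f y ≠ 0}) = 0 := by
  obtain ⟨-, hf, φ, hφ, ⟨g, hg, hgrad, hu0, hg0⟩, ht⟩ := h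
  have hgz := IsWeakGradient_ae_eq_zero hU hgrad hu
  have hu0' : Tendsto (fun k => eLpNorm (φ k) 2 (volume.restrict U)) atTop (𝓝 0) := by
    refine hu0.congr fun k => eLpNorm_congr_ae ?_
    filter_upwards [ae_restrict_mem hU.measurableSet] with x hx
    simp [hu hx]
  have hg0' : Tendsto (fun k => eLpNorm (gradient (φ k)) 2 (volume.restrict U)) atTop (𝓝 0) := by
    refine hg0.congr fun k => eLpNorm_congr_ae ?_
    filter_upwards [hgz] with x hx
    simp [hx]
  have hSU : ∀ p ∈ I ×ˢ Ioo 0 δ, G p ∈ U := fun p hp => hstrip p.1 hp.1 p.2 hp.2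
  have hmeas : Measurable fun x : ℝ => G (x, 0) :=
    (hG.continuous.comp (by fun_prop : Continuous fun x : ℝ => (x, (0 : ℝ)))).measurable
  -- A Lipschitz map enlarges one-dimensional Hausdorff measure by at most the factor `L`, so arc
  -- length on `N` is dominated by Lebesgue measure on the parameter set.
  have hle : (arcLength Γ).restrict N ≤
      (L : ℝ≥0∞) • (volume.restrict I).map (fun x => G (x, 0)) := by
    refine Measure.le_iff.2 fun B hB => ?_
    rw [Measure.smul_apply, Measure.map_apply hmeas hB, Measure.restrict_apply hB, arcLength,
      Measure.restrict_apply (hB.inter hN), Measure.restrict_apply (hmeas hB),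
      ← hausdorffMeasure_real, smul_eq_mul]
    have := (hL.mono inter_subset_right :
      LipschitzOnWith L (fun x => G (x, 0)) ((fun x => G (x, 0)) ⁻¹' B ∩ I)).hausdorffMeasure_image_le
        zero_le_one
    rw [ENNReal.rpow_one] at this
    refine le_trans (measure_mono ?_) this
    rintro y ⟨⟨hyB, hyN⟩, hyΓ⟩
    obtain ⟨x, hx, rfl⟩ := hNΓ y ⟨hyN, hyΓ⟩
    exact ⟨x, ⟨hyB, hx⟩, rfl⟩
  have hbase : ∀ k, eLpNorm (φ k) 2 ((arcLength Γ).restrict N) ^ 2 ≤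
      L * ∫⁻ x in I, ‖φ k (G (x, 0))‖ₑ ^ 2 := by
    intro k
    rw [eLpNorm_two_sq]
    refine (lintegral_mono' hle le_rfl).trans (le_of_eq ?_)
    rw [lintegral_smul_measure,
      lintegral_map (((hφ k).continuous.enorm.measurable).pow_const 2) hmeas, smul_eq_mul]
  have hδ' : ENNReal.ofReal δ ≠ 0 := by simpa using hδ
  have hbound : ∀ k, ENNReal.ofReal δ * eLpNorm (φ k) 2 ((arcLength Γ).restrict N) ^ 2 ≤
      L * (2 * eLpNorm (φ k) 2 (volume.restrict U) ^ 2 +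
        2 * (ENNReal.ofReal δ ^ 2 * eLpNorm (gradient (φ k)) 2 (volume.restrict U) ^ 2)) := by
    intro k
    calc ENNReal.ofReal δ * eLpNorm (φ k) 2 ((arcLength Γ).restrict N) ^ 2
        ≤ ENNReal.ofReal δ * (L * ∫⁻ x in I, ‖φ k (G (x, 0))‖ₑ ^ 2) := by
          gcongr
          exact hbase k
      _ = L * (ENNReal.ofReal δ * ∫⁻ x in I, ‖φ k (G (x, 0))‖ₑ ^ 2) := by ring
      _ ≤ _ := by
          gcongr
          refine (hG.lintegral_base_le (hφ k) I hδ.le).trans ?_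
          gcongr
          · exact hG.lintegral_comp_le hU.measurableSet hSU (hφ k).continuous.aestronglyMeasurable
          · exact hG.lintegral_comp_le hU.measurableSet hSU
              (continuous_gradient (hφ k)).aestronglyMeasurable
  have hlim : Tendsto (fun k => (L : ℝ≥0∞) * (2 * eLpNorm (φ k) 2 (volume.restrict U) ^ 2 +
      2 * (ENNReal.ofReal δ ^ 2 * eLpNorm (gradient (φ k)) 2 (volume.restrict U) ^ 2))) atTop
      (𝓝 (L * (2 * 0 ^ 2 + 2 * (ENNReal.ofReal δ ^ 2 * 0 ^ 2)))) := by
    refine ENNReal.Tendsto.const_mul (Tendsto.add (ENNReal.Tendsto.const_mul (ENNReal.Tendsto.pow hu0') ?_)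
      (ENNReal.Tendsto.const_mul (ENNReal.Tendsto.const_mul (ENNReal.Tendsto.pow hg0') ?_) ?_)) ?_ <;>
    right <;> simp
  have hφN : Tendsto (fun k => eLpNorm (φ k) 2 ((arcLength Γ).restrict N)) atTop (𝓝 0) := by
    have h1 := tendsto_of_tendsto_of_tendsto_of_le_of_le tendsto_const_nhds
      (by simpa using hlim) (fun _ => zero_le) hbound
    have h2 := ENNReal.Tendsto.const_mul (a := (ENNReal.ofReal δ)⁻¹) h1
      (Or.inr (by simpa using hδ))
    simp only [← mul_assoc, ENNReal.inv_mul_cancel hδ' ENNReal.ofReal_ne_top, one_mul, mul_zero]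
      at h2
    have h3 := ((ENNReal.continuous_rpow_const (y := (2 : ℝ)⁻¹)).tendsto 0).comp h2
    rw [ENNReal.zero_rpow_of_pos (by norm_num)] at h3
    refine h3.congr fun k => ?_
    simp only [Function.comp_apply]
    rw [← ENNReal.rpow_natCast, ← ENNReal.rpow_mul]
    norm_num
  -- On `N` the approximations converge in `L²` both to `0` and to `f`.
  have hfN : eLpNorm f 2 ((arcLength Γ).restrict N) = 0 := by
    have hfm : AEStronglyMeasurable f ((arcLength Γ).restrict N) := hf.1.restrict
    refine le_antisymm (ge_of_tendsto' (by simpa using hφN.add ht) fun k => ?_) zero_le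
    have h1 : f = φ k - fun x => φ k x - f x := by ext x; simp
    have hφm : AEStronglyMeasurable (φ k) ((arcLength Γ).restrict N) :=
      (hφ k).continuous.aestronglyMeasurable
    calc eLpNorm f 2 ((arcLength Γ).restrict N)
        = eLpNorm (φ k - fun x => φ k x - f x) 2 ((arcLength Γ).restrict N) := by rw [← h1]
      _ ≤ eLpNorm (φ k) 2 ((arcLength Γ).restrict N) +
          eLpNorm (fun x => φ k x - f x) 2 ((arcLength Γ).restrict N) :=
          eLpNorm_sub_le hφm (hφm.sub hfm) one_le_two
      _ ≤ _ := by
          gcongr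
          exact Measure.restrict_le_self
  rw [eLpNorm_eq_zero_iff hf.1.restrict two_ne_zero, EventuallyEq, ae_restrict_iff' hN] at hfN
  refine measure_mono_null (fun y hy => ?_) hfN
  simpa using hy

end

/-! ### Traces on `∂Ω` and on straight edges. -/

noncomputable section

open scoped ENNReal NNReal ComplexConjugate

/-- The standard isometry between the complex numbers and the Euclidean plane. -/
def complexPlane : ℂ ≃ₗᵢ[ℝ] Plane := Complex.orthonormalBasisOneI.repr

theorem complexPlane_zero (z : ℂ) : complexPlane z 0 = z.re := by simp [complexPlane]

theorem complexPlane_one (z : ℂ) : complexPlane z 1 = z.im := by simp [complexPlane]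

theorem cross_complexPlane (z w : ℂ) :
    cross (complexPlane z) (complexPlane w) = (conj z * w).im := by
  simp [cross, complexPlane_zero, complexPlane_one, Complex.mul_im]
  ring

/-- The vertical shear `(x, t) ↦ (x, γ x + t)` preserves area by translation invariance on each
fibre; mere continuity of `γ` suffices. -/
theorem isStripChart_graph (L : ℂ ≃ₗᵢ[ℝ] Plane) (c : Plane) {γ : ℝ → ℝ} (hγ : Continuous γ) :
    IsStripChart fun p => L ⟨p.1, γ p.1 + p.2⟩ + c := by
  have hmk : Continuous fun p : ℝ × ℝ => (⟨p.1, γ p.1 + p.2⟩ : ℂ) := by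
    have : (fun p : ℝ × ℝ => (⟨p.1, γ p.1 + p.2⟩ : ℂ)) =
        fun p => (p.1 : ℂ) + ((γ p.1 + p.2 : ℝ) : ℂ) * Complex.I := by
      funext p
      apply Complex.ext <;> simp
    rw [this]
    fun_prop
  refine ⟨?_, (L.continuous.comp hmk).add_const c, L Complex.I, by simp, fun x t => ?_⟩
  · have hshear : MeasurePreserving (fun p : ℝ × ℝ => (p.1, γ p.1 + p.2)) volume volume := by
      rw [Measure.volume_eq_prod]
      exact (MeasurePreserving.id volume).skew_product (g := fun x t => γ x + t)
        (by fun_prop) (ae_of_all _ fun x => map_add_left_eq_self volume (γ x))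
    have hm := Complex.volume_preserving_equiv_real_prod.symm.comp hshear
    exact (L.measurePreserving.comp hm).add_right volume c
  · have : (⟨x, γ x + t⟩ : ℂ) = ⟨x, γ x + 0⟩ + t • Complex.I := by
      apply Complex.ext <;> simp
    rw [this, map_add, map_smul]
    abel

theorem affineIsometry_symm_apply (e : Plane ≃ᵃⁱ[ℝ] Plane) (y : Plane) :
    e.symm y = e.symm.linearIsometryEquiv y + e.symm 0 := by
  have := e.symm.map_vadd 0 y
  simpa using this

/-- If a function vanishes in `Ω \ K`, then so does its trace on `∂Ω`. -/
theorem trace_frontier_ae_eq_zero {Ω K : Set Plane} (hΩ : IsBoundedC2Domain Ω) (hK : IsClosed K)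
    (hKΩ : K ⊆ Ω) {u f : Plane → ℝ} (hu : EqOn u 0 (Ω \ K))
    (h : HasTrace (Ω \ K) (frontier Ω) u f) : f =ᵐ[arcLength (frontier Ω)] 0 := by
  have hcompl : arcLength (frontier Ω) (frontier Ω)ᶜ = 0 := by
    rw [arcLength, Measure.restrict_apply isClosed_frontier.measurableSet.compl]
    simp
  change arcLength (frontier Ω) {y | f y ≠ 0} = 0
  refine measure_null_of_locally_null _ fun x _ => ?_
  by_cases hx : x ∉ frontier Ω
  · exact ⟨_, mem_nhdsWithin_of_mem_nhds (isClosed_frontier.isOpen_compl.mem_nhds hx), hcompl⟩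
  push Not at hx
  obtain ⟨V, e, γ, hV, hxV, hγ, hgraph⟩ := hΩ.locally_graph x hx
  have hc : ∀ i, Continuous fun y => e y i := fun i =>
    (EuclideanSpace.proj i : Plane →L[ℝ] ℝ).continuous.comp e.continuous
  have hc0 := hc 0
  have hc1 := hc 1
  -- A boundary point is not above the graph, since it is not in the open set `Ω`, and not below it,
  -- where a neighbourhood would miss `Ω`.
  have hon : ∀ y ∈ V, y ∈ frontier Ω → e y 1 = γ (e y 0) := by
    intro y hy hyf
    rw [hΩ.isOpen.frontier_eq] at hyf
    refine le_antisymm (not_lt.1 fun h => hyf.2 ((hgraph y hy).2 h)) (not_lt.1 fun h => ?_)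
    have hev : ∀ᶠ z in 𝓝 y, z ∉ Ω := by
      filter_upwards [hV.mem_nhds hy, (isOpen_lt hc1 (hγ.continuous.comp hc0)).mem_nhds h]
        with z hz hz' hzΩ
      exact lt_asymm hz' ((hgraph z hz).1 hzΩ)
    exact (mem_closure_iff_frequently.1 hyf.1) hev
  let L : ℂ ≃ₗᵢ[ℝ] Plane := complexPlane.trans e.symm.linearIsometryEquiv
  let G : ℝ × ℝ → Plane := fun p => L ⟨p.1, γ p.1 + p.2⟩ + e.symm 0
  have hG : IsStripChart G := isStripChart_graph L _ hγ.continuous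
  have heG : ∀ p, e (G p) = complexPlane ⟨p.1, γ p.1 + p.2⟩ := by
    intro p
    have : G p = e.symm (complexPlane ⟨p.1, γ p.1 + p.2⟩) := (affineIsometry_symm_apply e _).symm
    rw [this, e.apply_symm_apply]
  have heG0 : ∀ p, e (G p) 0 = p.1 := fun p => by rw [heG, complexPlane_zero]
  have heG1 : ∀ p, e (G p) 1 = γ p.1 + p.2 := fun p => by rw [heG, complexPlane_one]
  have hGe : ∀ y ∈ V, y ∈ frontier Ω → G (e y 0, 0) = y := by
    intro y hy hyf
    apply e.injective
    ext i
    fin_cases i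
    · exact heG0 _
    · exact (heG1 _).trans (by simp [hon y hy hyf])
  have hxK : x ∉ K := fun h => by
    rw [hΩ.isOpen.frontier_eq] at hx
    exact hx.2 (hKΩ h)
  have hGx : ∀ᶠ p in 𝓝 (e x 0, (0 : ℝ)), G p ∈ V ∩ Kᶜ := by
    refine hG.continuous.continuousAt.eventually ((hV.inter hK.isOpen_compl).mem_nhds ?_)
    rw [hGe x hxV hx]
    exact ⟨hxV, hxK⟩
  have hlip : ContDiffAt ℝ 1 (fun s : ℝ => G (s, 0)) (e x 0) := by
    have hmk : (fun s : ℝ => G (s, 0)) =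
        fun s : ℝ => L ((s : ℂ) + ((γ s : ℝ) : ℂ) * Complex.I) + e.symm 0 := by
      ext1 s
      simp only [G]
      congr 2
      apply Complex.ext <;> simp
    rw [hmk]
    have h1 : ContDiff ℝ 1 fun s : ℝ => (s : ℂ) := Complex.ofRealCLM.contDiff
    have h2 : ContDiff ℝ 1 fun s : ℝ => ((γ s : ℝ) : ℂ) :=
      Complex.ofRealCLM.contDiff.comp (hγ.of_le one_le_two)
    exact (L.contDiff.comp (h1.add (h2.mul contDiff_const))).add contDiff_const |>.contDiffAt
  obtain ⟨C, J, hJ, hC⟩ := hlip.exists_lipschitzOnWith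
  obtain ⟨ε, hε, hεG⟩ := Metric.eventually_nhds_iff.1 hGx
  obtain ⟨ε', hε', hεJ⟩ := Metric.mem_nhds_iff.1 hJ
  let I := Metric.ball (e x 0) (min ε ε')
  have hmin : 0 < min ε ε' := lt_min hε hε'
  let N := V ∩ (fun y => e y 0) ⁻¹' I
  have hN : IsOpen N := hV.inter (Metric.isOpen_ball.preimage hc0)
  have hxN : x ∈ N := ⟨hxV, Metric.mem_ball_self hmin⟩
  refine ⟨N ∩ {y | f y ≠ 0}, inter_mem (mem_nhdsWithin_of_mem_nhds (hN.mem_nhds hxN))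
    self_mem_nhdsWithin, ?_⟩
  refine trace_ae_eq_zero_of_strip (hΩ.isOpen.sdiff hK) hu h hG
    (hC.mono fun s hs => hεJ (Metric.ball_subset_ball (min_le_right _ _) hs)) hε hN.measurableSet
    (fun y hy => ⟨e y 0, hy.1.2, hGe y hy.1.1 hy.2⟩) fun s hs t ht => ?_
  have hd : dist (s, t) (e x 0, (0 : ℝ)) < ε := by
    rw [Prod.dist_eq]
    refine max_lt (lt_of_lt_of_le hs (min_le_left _ _)) ?_
    rw [Real.dist_eq, sub_zero, abs_of_pos ht.1]
    exact ht.2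
  obtain ⟨hGV, hGK⟩ := hεG hd
  refine ⟨(hgraph _ hGV).2 ?_, hGK⟩
  rw [heG0, heG1]
  simpa using ht.1

/-- A function with trace zero on `∂D` that extends continuously across a point of a straight
segment in `∂D` vanishes there. -/
theorem eq_zero_of_trace_zero_on_segment {Ω K Γ : Set Plane} (hΩ : IsOpen Ω) (hK : IsClosed K)
    (hKΩ : K ⊆ Ω) {u : Plane → ℝ} (h : HasTrace (Ω \ K) Γ u (fun _ => 0))
    {p q x : Plane} (hpq : p ≠ q) (hseg : segment ℝ p q ⊆ Γ) (hΓK : Γ ⊆ K)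
    (hside : ∀ y ∈ K, 0 ≤ cross (q - p) (y - p)) (hx : x ∈ segment ℝ p q)
    {N : Set Plane} {w : Plane → ℝ} (hN : IsOpen N) (hxN : x ∈ N) (hw : ContinuousOn w N)
    (hwu : EqOn w u (N ∩ (Ω \ K))) : w x = 0 := by
  by_contra hne
  let d : ℂ := complexPlane.symm (q - p)
  have hd : complexPlane d = q - p := complexPlane.apply_symm_apply _
  have hd0 : d ≠ 0 := by
    intro h0
    rw [h0, map_zero] at hd
    exact hpq (sub_eq_zero.1 hd.symm).symm
  set ℓ : ℝ := ‖d‖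
  have hℓ : 0 < ℓ := norm_pos_iff.2 hd0
  let k : Circle := ⟨d / ℓ, by
    have : ‖d / ℓ‖ = 1 := by
      rw [norm_div, Complex.norm_real, norm_norm, div_self hℓ.ne']
    simpa [Submonoid.unitSphere] using this⟩
  -- The conjugation turns the fibres to the right of the edge, so that `t > 0` points out of `K`.
  let L : ℂ ≃ₗᵢ[ℝ] Plane := (Complex.conjLIE.trans (rotation k)).trans complexPlane
  have hL : ∀ z, L z = complexPlane (d / ℓ * conj z) := fun z => rfl
  let G : ℝ × ℝ → Plane := fun p' => L ⟨p'.1, 0 + p'.2⟩ + p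
  have hG : IsStripChart G := isStripChart_graph L p (γ := fun _ => 0) continuous_const
  have hG0 : ∀ s : ℝ, G (s, 0) = p + (s / ℓ) • (q - p) := by
    intro s
    have h1 : d / ℓ * conj (⟨s, 0 + 0⟩ : ℂ) = ((s / ℓ : ℝ) : ℂ) * d := by
      have : (⟨s, 0 + 0⟩ : ℂ) = (s : ℂ) := by apply Complex.ext <;> simp
      rw [this, Complex.conj_ofReal]
      push_cast
      ring
    simp only [G, hL]
    rw [h1, ← Complex.real_smul, map_smul, hd, add_comm]
  have hiso : Isometry fun s => G (s, 0) := by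
    refine Isometry.of_dist_eq fun s t => ?_
    simp only [G, dist_add_right, L.dist_map]
    rw [Complex.dist_eq, Real.dist_eq, ← Real.norm_eq_abs, ← Complex.norm_real]
    congr 1
    apply Complex.ext <;> simp
  obtain ⟨θ, hθ, hθx⟩ : ∃ θ ∈ Icc (0 : ℝ) 1, p + θ • (q - p) = x := by
    rwa [segment_eq_image'] at hx
  have hs₀ : G (θ * ℓ, 0) = x := by
    rw [hG0, mul_div_cancel_right₀ _ hℓ.ne', hθx]
  have hc : 0 < |w x| / 2 := by positivity
  have hnear : ∀ᶠ p' in 𝓝 (θ * ℓ, (0 : ℝ)), G p' ∈ N ∧ |w x| / 2 < |w (G p')| ∧ G p' ∈ Ω := by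
    have hxK : x ∈ K := hΓK (hseg hx)
    have : ∀ᶠ y in 𝓝 x, y ∈ N ∧ |w x| / 2 < |w y| ∧ y ∈ Ω := by
      filter_upwards [hN.mem_nhds hxN, ((hw.continuousAt (hN.mem_nhds hxN)).abs).eventually
        (lt_mem_nhds (show |w x| / 2 < |w x| by linarith)), hΩ.mem_nhds (hKΩ hxK)]
        with y h1 h2 h3 using ⟨h1, h2, h3⟩
    rw [← hs₀] at this ⊢
    exact hG.continuous.continuousAt.eventually this
  obtain ⟨ε, hε, hεG⟩ := Metric.eventually_nhds_iff.1 hnear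
  have hθ0 : 0 ≤ θ * ℓ := mul_nonneg hθ.1 hℓ.le
  have hθ1 : θ * ℓ ≤ ℓ := mul_le_of_le_one_left hℓ.le hθ.2
  refine not_bounded_below_of_trace_zero (hΩ.sdiff hK).measurableSet h hG hiso
    -- Clipping to `[0, ℓ]` keeps the base on the edge; the interval stays nonempty when `x` is an
    -- endpoint.
    (α := max 0 (θ * ℓ - ε)) (β := min ℓ (θ * ℓ + ε)) ?_ hε hc ?_ ?_
  · refine max_lt (lt_min hℓ (by linarith)) (lt_min ?_ ?_) <;> linarith
  · intro s hs
    refine hseg ?_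
    rw [segment_eq_image']
    have h0 : 0 < s := (le_max_left _ _).trans_lt hs.1
    have h1 : s < ℓ := hs.2.trans_le (min_le_left _ _)
    exact ⟨s / ℓ, ⟨by positivity, (div_le_one hℓ).2 h1.le⟩, (hG0 s).symm⟩
  · intro s hs t ht
    have hdist : dist (s, t) (θ * ℓ, (0 : ℝ)) < ε := by
      rw [Prod.dist_eq]
      refine max_lt ?_ ?_
      · rw [Real.dist_eq, abs_lt]
        have h1 := (le_max_right _ _).trans_lt hs.1
        have h2 := hs.2.trans_le (min_le_right _ _)
        constructor <;> linarith
      · rw [Real.dist_eq, sub_zero, abs_of_pos ht.1]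
        exact ht.2
    obtain ⟨h1, h2, h3⟩ := hεG hdist
    have hout : G (s, t) ∉ K := by
      intro hmem
      have h4 := hside _ hmem
      simp only [G, hL, add_sub_cancel_right] at h4
      rw [← hd, cross_complexPlane] at h4
      have h5 : conj d * (d / ℓ * conj (⟨s, 0 + t⟩ : ℂ)) = (ℓ : ℂ) * conj (⟨s, 0 + t⟩ : ℂ) := by
        have : conj d * d = (ℓ : ℂ) ^ 2 := by
          rw [← Complex.normSq_eq_conj_mul_self, Complex.normSq_eq_norm_sq]
          push_cast
          rfl
        have hℓc : (ℓ : ℂ) ≠ 0 := by exact_mod_cast hℓ.ne'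
        field_simp
        linear_combination conj (⟨s, 0 + t⟩ : ℂ) * this
      rw [h5, Complex.im_ofReal_mul] at h4
      simp only [Complex.conj_im, zero_add, mul_neg, Left.nonneg_neg_iff] at h4
      have := mul_pos hℓ ht.1
      linarith
    have hmem : G (s, t) ∈ Ω \ K := ⟨h3, hout⟩
    exact ⟨hmem, by rw [← hwu ⟨h1, hmem⟩]; exact h2.le⟩

end

/-! ### Geometry of convex polygons. -/

noncomputable section

open scoped ComplexConjugate

theorem cross_add_right (v w w' : Plane) : cross v (w + w') = cross v w + cross v w' := by
  simp [cross]; ring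

theorem cross_smul_right (v w : Plane) (c : ℝ) : cross v (c • w) = c * cross v w := by
  simp [cross]; ring

theorem cross_self_eq_zero (v : Plane) : cross v v = 0 := by simp [cross]; ring

theorem cross_neg_left (v w : Plane) : cross (-v) w = -cross v w := by simp [cross]; ring

theorem cross_neg_right (v w : Plane) : cross v (-w) = -cross v w := by simp [cross]; ring

theorem cross_swap (v w : Plane) : cross w v = -cross v w := by simp [cross]; ring

theorem cross_zero_right (v : Plane) : cross v 0 = 0 := by simp [cross]

/-- The linear relation between three vectors in the plane. -/
theorem cross_smul_add (a b d : Plane) :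
    cross b d • a + cross d a • b + cross a b • d = 0 := by
  ext i
  fin_cases i <;> simp [cross] <;> ring

theorem linear_eq_zero_of_cross_ne_zero (f : Plane →ₗ[ℝ] ℝ) {a d : Plane} (ha : f a = 0)
    (hd : f d = 0) (h : cross a d ≠ 0) (y : Plane) : f y = 0 := by
  have := congrArg f (cross_smul_add y a d)
  simp only [map_add, map_smul, ha, hd, smul_eq_mul, mul_zero, add_zero, map_zero] at this
  exact (mul_eq_zero.1 this).resolve_left h

theorem isCompact_polygon_hull {n : ℕ} (P : Polygon Plane n) :
    IsCompact (convexHull ℝ (range P.vertices)) :=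
  (finite_range _).isCompact_convexHull ℝ

namespace IsConvexPolygon

variable {n : ℕ} [NeZero n] {P : Polygon Plane n}

theorem add_one_ne (hP : IsConvexPolygon P) (i : Fin n) : i + 1 ≠ i := by
  have h3 := hP.three_le
  intro h
  have h1 : (1 : Fin n) = 0 := by simpa using h
  have h2 := congrArg Fin.val h1
  rw [Fin.val_one', Fin.val_zero, Nat.mod_eq_of_lt (by omega)] at h2
  omega

theorem sub_one_ne (hP : IsConvexPolygon P) (i : Fin n) : i - 1 ≠ i := by
  intro h
  have := hP.add_one_ne (i - 1)
  rw [sub_add_cancel] at this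
  exact this h.symm

theorem sub_one_ne_add_one (hP : IsConvexPolygon P) (i : Fin n) : i - 1 ≠ i + 1 := by
  have h3 := hP.three_le
  intro h
  have h1 : (1 + 1 : Fin n) = 0 := by
    have := sub_eq_iff_eq_add.1 h
    rw [add_assoc] at this
    simpa using this
  have h2 := congrArg Fin.val h1
  rw [Fin.val_add, Fin.val_one', Fin.val_zero, Nat.mod_eq_of_lt (show 1 < n by omega),
    Nat.mod_eq_of_lt (by omega)] at h2
  omega

theorem cross_corner_pos (hP : IsConvexPolygon P) (i : Fin n) :
    0 < cross (P (i + 1) - P i) (P (i - 1) - P i) :=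
  hP.left_of_edge i (i - 1) (hP.sub_one_ne i) (hP.sub_one_ne_add_one i)

theorem edge_ne (hP : IsConvexPolygon P) (i : Fin n) : P i ≠ P (i + 1) := by
  intro h
  have := hP.cross_corner_pos i
  rw [h, sub_self] at this
  simp [cross] at this

theorem cross_nonneg (hP : IsConvexPolygon P) (i : Fin n) {y : Plane}
    (hy : y ∈ convexHull ℝ (range P.vertices)) : 0 ≤ cross (P (i + 1) - P i) (y - P i) := by
  have hsub : convexHull ℝ (range P.vertices) ⊆
      {y | 0 ≤ cross (P (i + 1) - P i) (y - P i)} := by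
    refine convexHull_min ?_ ?_
    · rintro _ ⟨j, rfl⟩
      change 0 ≤ cross (P (i + 1) - P i) (P j - P i)
      by_cases h1 : j = i
      · rw [h1, sub_self, cross_zero_right]
      by_cases h2 : j = i + 1
      · rw [h2, cross_self_eq_zero]
      · exact (hP.left_of_edge i j h1 h2).le
    · intro x hx z hz a b ha hb hab
      have : a • x + b • z - P i = a • (x - P i) + b • (z - P i) := by
        have : P i = (a + b) • P i := by rw [hab, one_smul]
        nth_rw 1 [this]
        module
      simp only [mem_ofPred_eq, this, cross_add_right, cross_smul_right] at hx hz ⊢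
      positivity
  exact hsub hy

/-- The two edge vectors at one corner have nonzero cross product, so they span the plane. -/
theorem interior_nonempty (hP : IsConvexPolygon P) :
    (interior (convexHull ℝ (range P.vertices))).Nonempty := by
  rw [interior_convexHull_nonempty_iff_affineSpan_eq_top,
    AffineSubspace.affineSpan_eq_top_iff_vectorSpan_eq_top_of_nonempty _ _ _ (range_nonempty _),
    eq_top_iff]
  intro y _
  have hc := hP.cross_corner_pos 0
  set a := P (0 + 1) - P 0
  set d := P (0 - 1) - P 0
  have ha : a ∈ vectorSpan ℝ (range P.vertices) :=
    vsub_mem_vectorSpan ℝ (mem_range_self _) (mem_range_self _)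
  have hd : d ∈ vectorSpan ℝ (range P.vertices) :=
    vsub_mem_vectorSpan ℝ (mem_range_self _) (mem_range_self _)
  have h := cross_smul_add y a d
  have hy : y = (cross a d)⁻¹ • (-(cross d y) • a - cross y a • d) := by
    rw [eq_inv_smul_iff₀ hc.ne']
    rw [add_assoc] at h
    rw [eq_neg_of_add_eq_zero_left h]
    module
  rw [hy]
  exact Submodule.smul_mem _ _ (Submodule.sub_mem _ (Submodule.smul_mem _ _ ha)
    (Submodule.smul_mem _ _ hd))

theorem closure_polygonRegion (hP : IsConvexPolygon P) :
    closure (polygonRegion P) = convexHull ℝ (range P.vertices) := by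
  rw [polygonRegion, (convex_convexHull ℝ _).closure_interior_eq_closure_of_nonempty_interior
    hP.interior_nonempty, (isCompact_polygon_hull P).isClosed.closure_eq]

theorem frontier_polygonRegion (hP : IsConvexPolygon P) :
    frontier (polygonRegion P) = frontier (convexHull ℝ (range P.vertices)) := by
  rw [(isCompact_polygon_hull P).isClosed.frontier_eq, frontier, hP.closure_polygonRegion, polygonRegion,
    interior_interior]

/-- The hull lies weakly to the left of each edge line, so a small step from the edge in the
direction opposite to the previous vertex leaves it. -/
theorem segment_subset_frontier (hP : IsConvexPolygon P) (i : Fin n) :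
    segment ℝ (P i) (P (i + 1)) ⊆ frontier (convexHull ℝ (range P.vertices)) := by
  rw [(isCompact_polygon_hull P).isClosed.frontier_eq]
  intro x hx
  refine ⟨(convex_convexHull ℝ _).segment_subset (subset_convexHull _ _ (mem_range_self _))
    (subset_convexHull _ _ (mem_range_self _)) hx, fun hint => ?_⟩
  have hx0 : cross (P (i + 1) - P i) (x - P i) = 0 := by
    rw [segment_eq_image'] at hx
    obtain ⟨t, -, rfl⟩ := hx
    rw [add_sub_cancel_left, cross_smul_right, cross_self_eq_zero, mul_zero]
  have hc := hP.cross_corner_pos i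
  set d := P (i - 1) - P i
  have hcont : Continuous fun t : ℝ => x + t • (-d) := by fun_prop
  have hev : ∀ᶠ t : ℝ in 𝓝[>] 0, x + t • (-d) ∈ interior (convexHull ℝ (range P.vertices)) := by
    have : Tendsto (fun t : ℝ => x + t • (-d)) (𝓝[>] 0) (𝓝 x) := by
      simpa using (hcont.tendsto 0).mono_left nhdsWithin_le_nhds
    exact this.eventually (isOpen_interior.mem_nhds hint)
  obtain ⟨t, ht, ht0⟩ := (hev.and self_mem_nhdsWithin).exists
  have h1 := hP.cross_nonneg i (interior_subset ht)
  rw [add_sub_right_comm, cross_add_right, hx0, cross_smul_right, cross_neg_right] at h1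
  have := mul_pos ht0 hc
  linarith

/-- The vertices at which a nonzero linear functional attains its maximum are contained in an
edge. -/
theorem exists_edge_of_maximizers (hP : IsConvexPolygon P) (f : Plane →ₗ[ℝ] ℝ)
    (hf : ∃ y, f y ≠ 0) {m : ℝ} (hm : ∀ j, f (P j) ≤ m) :
    ∃ i, ∀ j, f (P j) = m → j = i ∨ j = i + 1 := by
  obtain ⟨y, hy⟩ := hf
  -- If two maximizers were not adjacent, the neighbours of `P i` would lie strictly on opposite
  -- sides of the line through them. As `f` does not exceed `m` at either neighbour, the linear
  -- relation forces `f A = 0`, and then `f = 0`.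
  have hadj : ∀ i j, f (P i) = m → f (P j) = m → j ≠ i → j ≠ i + 1 → i = j + 1 := by
    intro i j hi hj hji hji1
    by_contra hij
    have hji' : j ≠ i - 1 := fun h => hij (by rw [h, sub_add_cancel])
    have h1 := hP.left_of_edge i j hji hji1
    have h2 := hP.left_of_edge (i - 1) j hji' (by rwa [sub_add_cancel])
    rw [sub_add_cancel] at h2
    set A := P (i + 1) - P i with hA
    set B := P (i - 1) - P i with hB
    set d := P j - P i with hd
    have e1 : P i - P (i - 1) = -B := by rw [hB]; abel
    have e2 : P j - P (i - 1) = d + -B := by rw [hB, hd]; abel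
    rw [e1, e2, cross_neg_left, cross_add_right, cross_neg_right, cross_self_eq_zero] at h2
    have fA : f A ≤ 0 := by rw [hA, map_sub, hi]; linarith [hm (i + 1)]
    have fB : f B ≤ 0 := by rw [hB, map_sub, hi]; linarith [hm (i - 1)]
    have fd : f d = 0 := by rw [hd, map_sub, hi, hj, sub_self]
    have h3 := congrArg f (cross_smul_add A B d)
    simp only [map_add, map_smul, fd, smul_eq_mul, mul_zero, add_zero, map_zero] at h3
    rw [cross_swap A d] at h3
    have fA0 : f A = 0 := by
      have h4 : 0 ≤ cross B d * f A := mul_nonneg_of_nonpos_of_nonpos (by linarith) fA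
      have h5 : cross A d * f B ≤ 0 := mul_nonpos_of_nonneg_of_nonpos h1.le fB
      have h6 : cross B d * f A = 0 := by linarith
      exact (mul_eq_zero.1 h6).resolve_left (by linarith)
    exact hy (linear_eq_zero_of_cross_ne_zero f fA0 fd h1.ne' y)
  have hthird : ∀ i, f (P i) = m → f (P (i + 1)) = m → ∀ j, f (P j) = m → j = i ∨ j = i + 1 := by
    intro i hi hi1 j hj
    by_contra! hcon
    have h1 := hP.left_of_edge i j hcon.1 hcon.2
    exact hy (linear_eq_zero_of_cross_ne_zero f (by rw [map_sub, hi, hi1, sub_self])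
      (by rw [map_sub, hi, hj, sub_self]) h1.ne' y)
  by_cases hone : ∃ i, f (P i) = m
  · obtain ⟨i, hi⟩ := hone
    by_cases htwo : ∃ j, f (P j) = m ∧ j ≠ i
    · obtain ⟨j, hj, hji⟩ := htwo
      by_cases hji1 : j = i + 1
      · exact ⟨i, hthird i hi (hji1 ▸ hj)⟩
      · have := hadj i j hi hj hji hji1
        exact ⟨j, hthird j hj (this ▸ hi)⟩
    · push Not at htwo
      exact ⟨i, fun j hj => Or.inl (htwo j hj)⟩
  · push Not at hone
    -- No vertex attains `m`, so any index serves.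
    exact ⟨0, fun j hj => absurd hj (hone j)⟩

/-- A supporting functional at `x` attains its maximum over the hull there, so `x` is a convex
combination of maximizing vertices alone, and these belong to one edge. -/
theorem exists_mem_segment_of_mem_frontier (hP : IsConvexPolygon P) {x : Plane}
    (hx : x ∈ frontier (convexHull ℝ (range P.vertices))) :
    ∃ i, x ∈ segment ℝ (P i) (P (i + 1)) := by
  rw [(isCompact_polygon_hull P).isClosed.frontier_eq] at hx
  obtain ⟨f, hf⟩ := geometric_hahn_banach_open_point
    (convex_convexHull ℝ (range P.vertices)).interior isOpen_interior hx.2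
  have hle : ∀ y ∈ convexHull ℝ (range P.vertices), f y ≤ f x := by
    intro y hy
    have hcl : closure (interior (convexHull ℝ (range P.vertices))) ⊆ {y | f y ≤ f x} :=
      closure_minimal (fun y hy => (hf y hy).le) (isClosed_le f.continuous continuous_const)
    have h := hP.closure_polygonRegion
    rw [polygonRegion] at h
    rw [h] at hcl
    exact hcl hy
  have hfne : ∃ y, f y ≠ 0 := by
    obtain ⟨y, hy⟩ := hP.interior_nonempty
    by_contra! h0
    have := hf y hy
    rw [h0, h0] at this
    exact lt_irrefl _ this
  have hvert : ∀ j, P j ∈ convexHull ℝ (range P.vertices) := fun j =>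
    subset_convexHull _ _ (mem_range_self j)
  obtain ⟨i, hi⟩ := hP.exists_edge_of_maximizers f.toLinearMap hfne (m := f x)
    fun j => hle _ (hvert j)
  refine ⟨i, ?_⟩
  have hxh := hx.1
  rw [convexHull_range_eq_exists_affineCombination] at hxh
  obtain ⟨s, w, hw0, hw1, hwx⟩ := hxh
  rw [Finset.affineCombination_eq_linear_combination _ _ _ hw1] at hwx
  have hzero : ∀ j ∈ s, w j * (f x - f (P j)) = 0 := by
    refine (Finset.sum_eq_zero_iff_of_nonneg fun j hj =>
      mul_nonneg (hw0 j hj) (sub_nonneg.2 (hle _ (hvert j)))).1 ?_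
    simp only [mul_sub, Finset.sum_sub_distrib, ← Finset.sum_mul, hw1, one_mul]
    rw [sub_eq_zero]
    nth_rw 1 [← hwx]
    simp only [map_sum, map_smul, smul_eq_mul]
  classical
  -- Vertices of weight zero are replaced by `P i`, so that every point of the combination lies on
  -- the edge.
  have hx' : x = ∑ j ∈ s, w j • (if w j = 0 then P i else P j) := by
    rw [← hwx]
    refine Finset.sum_congr rfl fun j _ => ?_
    by_cases h : w j = 0
    · simp [h]
    · simp only [h, if_false]
  rw [hx']
  refine (convex_segment _ _).sum_mem hw0 hw1 fun j hj => ?_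
  by_cases h : w j = 0
  · simp only [h, if_true]
    exact left_mem_segment _ _ _
  · simp only [h, if_false]
    have hj' := (mul_eq_zero.1 (hzero j hj)).resolve_left h
    rcases hi j (by simpa using (sub_eq_zero.1 hj').symm) with rfl | rfl
    · exact left_mem_segment _ _ _
    · exact right_mem_segment _ _ _

end IsConvexPolygon

/-! ### Corner angles, distances, and transfer to the complex plane. -/

/-- No power of a complex number whose argument is an irrational angle is real. -/
theorem im_pow_ne_zero_of_irrational {q : ℂ} (hq : q ≠ 0) (h : IsIrrationalAngle |q.arg|) {m : ℕ}
    (hm : 0 < m) : (q ^ m).im ≠ 0 := by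
  intro h0
  obtain ⟨α, hα, hθ⟩ := h
  have hpow : (q ^ m).im = ‖q‖ ^ m * Real.sin (m * q.arg) := by
    conv_lhs => rw [← Complex.norm_mul_exp_arg_mul_I q]
    rw [mul_pow, ← Complex.exp_nat_mul, ← Complex.ofReal_pow, Complex.im_ofReal_mul,
      show (m : ℂ) * (q.arg * Complex.I) = ((m * q.arg : ℝ) : ℂ) * Complex.I by push_cast; ring,
      Complex.exp_ofReal_mul_I_im]
  rw [hpow] at h0
  have hs := (mul_eq_zero.1 h0).resolve_left (pow_ne_zero _ (norm_ne_zero_iff.2 hq))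
  obtain ⟨k, hk⟩ := Real.sin_eq_zero_iff.1 hs
  have hm' : (m : ℝ) ≠ 0 := by exact_mod_cast hm.ne'
  have habs : |(k : ℝ)| * Real.pi = m * (2 * Real.pi * α) := by
    have := congrArg abs hk
    rwa [abs_mul, abs_mul, abs_of_pos Real.pi_pos, Nat.abs_cast, hθ] at this
  have : α = ((|k| : ℤ) : ℝ) / ((2 * m : ℤ) : ℝ) := by
    have hpi := Real.pi_pos.ne'
    push_cast
    field_simp
    apply mul_right_cancel₀ hpi
    linarith
  exact (irrational_iff_ne_rational α).1 hα _ _ (by omega) this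

theorem cornerAngle_eq_abs_arg {n : ℕ} [NeZero n] (P : Polygon Plane n) (i : Fin n) {e₁ e₂ : ℂ}
    (h₁ : complexPlane e₁ = P (i + 1) - P i) (h₂ : complexPlane e₂ = P (i - 1) - P i)
    (he₁ : e₁ ≠ 0) (he₂ : e₂ ≠ 0) : cornerAngle P i = |(conj e₁ * e₂).arg| := by
  have hsq : conj e₁ * e₂ = (Complex.normSq e₁ : ℂ) * (e₂ / e₁) := by
    rw [Complex.normSq_eq_conj_mul_self]
    field_simp
  rw [cornerAngle, EuclideanGeometry.angle, vsub_eq_sub, vsub_eq_sub, ← h₁, ← h₂, hsq,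
    Complex.arg_real_mul _ (Complex.normSq_pos.2 he₁), ← Complex.angle_eq_abs_arg he₂ he₁]
  exact complexPlane.toLinearIsometry.angle_map _ _

/-- The ball is connected, meets `Ω` at its centre, and contains no point of `∂Ω`; the distance
bound passes from `D` to its closure by continuity. -/
theorem ball_subset_of_setDist {Ω D : Set Plane} (hΩ : IsOpen Ω) {a : Plane}
    (ha : a ∈ closure D) (haΩ : a ∈ Ω) : Metric.ball a (setDist D (frontier Ω)) ⊆ Ω := by
  rcases le_or_gt (setDist D (frontier Ω)) 0 with hR | hR
  · rw [Metric.ball_eq_empty.2 hR]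
    exact empty_subset _
  have hbdd : BddBelow (image2 dist D (frontier Ω)) := by
    refine ⟨0, ?_⟩
    rintro _ ⟨_, _, _, _, rfl⟩
    exact dist_nonneg
  have hdist : ∀ y ∈ frontier Ω, setDist D (frontier Ω) ≤ dist a y := by
    intro y hy
    have hcl : closure D ⊆ {x | setDist D (frontier Ω) ≤ dist x y} := by
      refine closure_minimal (fun x hx => ?_) (isClosed_le continuous_const (by fun_prop))
      exact csInf_le hbdd (mem_image2_of_mem hx hy)
    exact hcl ha
  refine (convex_ball a _).isPreconnected.subset_of_closure_inter_subset hΩ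
    ⟨a, Metric.mem_ball_self hR, haΩ⟩ fun y hy => ?_
  by_contra hyΩ
  have hyf : y ∈ frontier Ω := by
    rw [hΩ.frontier_eq]
    exact ⟨hy.1, hyΩ⟩
  have h1 := hdist y hyf
  have h2 := Metric.mem_ball'.1 hy.2
  linarith

/-- If the solution continues analytically across a corner of the polygon, it vanishes. -/
theorem solution_eq_zero_of_analytic_continuation
    {Ω : Set Plane} (hΩ : IsBoundedC2Domain Ω)
    {n : ℕ} [NeZero n] {P : Polygon Plane n} (hP : IsConvexPolygon P)
    (hDΩ : closure (polygonRegion P) ⊆ Ω) (hconn : IsConnected (Ω \ closure (polygonRegion P)))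
    {f u : Plane → ℝ} (hu : IsSolution Ω (polygonRegion P) f u)
    (hcase : (∀ i : Fin n, IsIrrationalAngle (cornerAngle P i)) ∨
      Metric.diam (polygonRegion P) < setDist (polygonRegion P) (frontier Ω))
    (i : Fin n) (hcont : HasAnalyticContinuationAt Ω (polygonRegion P) u (P i)) :
    EqOn u 0 (Ω \ closure (polygonRegion P)) := by
  obtain ⟨V, v, hVo, haV, hv, hvu⟩ := hcont
  have hharm := hu.harmonic
  have htrace := hu.trace_inner
  have hcl := hP.closure_polygonRegion
  have hfr := hP.frontier_polygonRegion
  have hdiam : Metric.diam (convexHull ℝ (range P.vertices)) = Metric.diam (polygonRegion P) := by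
    rw [← hcl, Metric.diam_closure]
  have haK : P i ∈ convexHull ℝ (range P.vertices) := subset_convexHull _ _ (mem_range_self i)
  have hball := ball_subset_of_setDist (Ω := Ω) (D := polygonRegion P) (a := P i) hΩ.isOpen
    (by rwa [hcl]) (hDΩ (by rwa [hcl]))
  rw [hcl] at hDΩ hconn hharm htrace hvu ⊢
  rw [hfr] at htrace
  have hKcpt := isCompact_polygon_hull P
  set K := convexHull ℝ (range P.vertices) with hKdef
  have hKcl : IsClosed K := hKcpt.isClosed
  set T := complexPlane
  let a : ℂ := T.symm (P i)
  let e₁ : ℂ := T.symm (P (i + 1) - P i)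
  let e₂ : ℂ := T.symm (P (i - 1) - P i)
  have hTa : T a = P i := T.apply_symm_apply _
  have hT₁ : T e₁ = P (i + 1) - P i := T.apply_symm_apply _
  have hT₂ : T e₂ = P (i - 1) - P i := T.apply_symm_apply _
  have hcross : 0 < (conj e₁ * e₂).im := by
    rw [← cross_complexPlane]
    change 0 < cross (T e₁) (T e₂)
    rw [hT₁, hT₂]
    exact hP.cross_corner_pos i
  have he₁ : e₁ ≠ 0 := by intro h; simp [h] at hcross
  have he₂ : e₂ ≠ 0 := by intro h; simp [h] at hcross
  have hTc : Continuous T := T.continuous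
  have hfrT : ∀ z, z ∈ frontier (T ⁻¹' K) ↔ T z ∈ frontier K := fun z => by
    have := T.toHomeomorph.preimage_frontier K
    exact (Set.ext_iff.1 this z).symm
  -- Every boundary point lies on some edge, so the segment version of the trace argument covers the
  -- whole boundary, corners included.
  have htr : ∀ x ∈ frontier K, ∀ (N : Set Plane) (w : Plane → ℝ), IsOpen N → x ∈ N →
      ContinuousOn w N → EqOn w u (N ∩ (Ω \ K)) → w x = 0 := by
    intro x hx N w hN hxN hw hwu
    obtain ⟨j, hj⟩ := hP.exists_mem_segment_of_mem_frontier hx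
    exact eq_zero_of_trace_zero_on_segment hΩ.isOpen hKcl hDΩ htrace (hP.edge_ne j)
      (hP.segment_subset_frontier j) hKcl.frontier_subset (fun y hy => hP.cross_nonneg j hy) hj
      hN hxN hw hwu
  have hmain : EqOn (fun z => u (T z)) 0 (T ⁻¹' (Ω \ K)) := by
    refine harmonic_eq_zero_of_analytic_continuation (K := T ⁻¹' K) (V := T ⁻¹' V)
      (v := fun z => v (T z)) (a := a) (e₁ := e₁) (e₂ := e₂) ?_ ?_ (hKcl.preimage hTc) ?_ ?_ ?_ ?_
      hcross ?_ ?_ ?_ ?_ (hVo.preimage hTc) ?_ ?_ ?_ ?_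
    · exact T.toHomeomorph.isPreconnected_preimage.2 hconn.isPreconnected
    · intro z hz
      have := HarmonicAt_comp_isometry T 0 (f := u) (x := z) (by simpa using hharm _ hz)
      simpa using this
    · exact (convex_convexHull ℝ _).linear_preimage T.toLinearEquiv.toLinearMap
    · have := T.toHomeomorph.preimage_interior K
      obtain ⟨y, hy⟩ := hP.interior_nonempty
      refine ⟨T.symm y, (Set.ext_iff.1 this _).1 ?_⟩
      change T (T.symm y) ∈ interior K
      rwa [T.apply_symm_apply]
    · change T a ∈ K
      rwa [hTa]
    · have : ∀ᶠ z in 𝓝 a, T z ∈ Ω :=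
        hTc.continuousAt.eventually (hΩ.isOpen.mem_nhds (hDΩ (by rwa [hTa])))
      filter_upwards [this] with z hz hzK using ⟨hz, hzK⟩
    · rw [Set.disjoint_left]
      intro z hz hzK
      have hsub : T (z - a) = T z - P i := by rw [map_sub, hTa]
      rcases hz with hz | hz
      · rw [← cross_complexPlane] at hz
        change cross (T e₁) (T (z - a)) < 0 at hz
        rw [hT₁, hsub] at hz
        exact absurd (hP.cross_nonneg i hzK) (not_le.2 hz)
      · rw [← cross_complexPlane] at hz
        change 0 < cross (T e₂) (T (z - a)) at hz
        rw [hsub] at hz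
        have h1 := hP.cross_nonneg (i - 1) hzK
        rw [sub_add_cancel, show P i - P (i - 1) = -(T e₂) by rw [hT₂]; abel,
          show T z - P (i - 1) = (T z - P i) + -(T e₂) by rw [hT₂]; abel, cross_neg_left,
          cross_add_right, cross_neg_right, cross_self_eq_zero] at h1
        linarith
    · intro t h0 h1
      rw [hfrT]
      refine hP.segment_subset_frontier i ?_
      rw [segment_eq_image']
      refine ⟨t, ⟨h0.le, h1.le⟩, ?_⟩
      rw [map_add, hTa, ← Complex.real_smul, map_smul, hT₁]
    · intro t h0 h1
      rw [hfrT]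
      refine hP.segment_subset_frontier (i - 1) ?_
      rw [sub_add_cancel, segment_symm, segment_eq_image']
      refine ⟨t, ⟨h0.le, h1.le⟩, ?_⟩
      rw [map_add, hTa, ← Complex.real_smul, map_smul, hT₂]
    · intro x hx N w hN hxN hw hwu
      have hpre := htr (T x) ((hfrT x).1 hx) (T.symm ⁻¹' N) (fun y => w (T.symm y))
        (hN.preimage T.symm.continuous) (by simpa using hxN)
        (hw.comp T.symm.continuous.continuousOn fun y hy => hy) (fun y hy => by
          have := hwu (x := T.symm y) ⟨hy.1, by
            change T (T.symm y) ∈ Ω \ K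
            rw [T.apply_symm_apply]
            exact hy.2⟩
          simpa using this)
      simpa using hpre
    · change T a ∈ V
      rwa [hTa]
    · intro z hz
      exact AnalyticAt.comp_of_eq (hv _ hz) (T.toContinuousLinearEquiv.analyticAt z) rfl
    · intro z hz
      exact hvu _ hz
    · rcases hcase with hirr | hdist
      · left
        intro m hm
        refine im_pow_ne_zero_of_irrational (by simp [he₁, he₂]) ?_ hm
        rw [← cornerAngle_eq_abs_arg P i hT₁ hT₂ he₁ he₂]
        exact hirr i
      · right
        -- The radii are `d = diam D` and `R = dist (D, ∂Ω)`: the first ball contains `K` because `a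
        -- ∈ K`, and the second lies in `Ω`.
        refine ⟨_, _, hdist, fun z hz => ?_, ?_⟩
        · rw [Metric.mem_closedBall, ← T.dist_map, hTa, ← hdiam]
          exact Metric.dist_le_diam_of_mem hKcpt.isBounded hz haK
        · ext z
          refine ⟨fun hz => ⟨hz.1, hball ?_, hz.2⟩, fun hz => ⟨hz.1, hz.2.2⟩⟩
          rw [Metric.mem_ball, ← hTa, T.dist_map]
          exact hz.1
  intro x hx
  have := hmain (x := T.symm x) (by
    change T (T.symm x) ∈ Ω \ K
    rwa [T.apply_symm_apply])
  simpa using this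

end
theorem proposition6p2
    (Ω : Set Plane) (hΩ : IsBoundedC2Domain Ω)
    {n : ℕ} [NeZero n] (P : Polygon Plane n) (hP : IsConvexPolygon P)
    (D : Set Plane) (hD : D = polygonRegion P)
    (hDΩ : closure D ⊆ Ω) (hconn : IsConnected (Ω \ closure D))
    (f : Plane → ℝ) (hf : MemHHalf (frontier Ω) f)
    (hf0 : ¬ f =ᵐ[arcLength (frontier Ω)] 0)
    (u : Plane → ℝ) (hu : IsSolution Ω D f u)
    (hcase : (∀ i : Fin n, IsIrrationalAngle (cornerAngle P i)) ∨
      Metric.diam D < setDist D (frontier Ω)) :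
    ∀ i : Fin n, ¬ HasAnalyticContinuationAt Ω D u (P i) := by
  subst hD
  exact fun i hi => hf0 (trace_frontier_ae_eq_zero hΩ isClosed_closure hDΩ
    (solution_eq_zero_of_analytic_continuation hΩ hP hDΩ hconn hu hcase i hi) hu.trace_outer)
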